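/- \textbf{Setting.} Let $\mathcal S,\mathcal A,\mathcal Z$ be finite sets, let $T$ be a horizon, let $\mu^{(0)}$ be a pmf on $\mathcal S$, and let $z:\mathcal S\to\mathcal Z$ assign an expert to each state; write $\mathcal S_z$ for the set of states of expert $z$. A real function on a convex set $D$ has the \emph{smooth extension property} if it extends continuously to a function that is continuously differentiable on an open neighbourhood of the relative interior of $D$ and whose gradient extends by continuity to all points of $D$. For $t=0,\dots,T-1$ and pmfs $\mu$ on $\mathcal S$ let $p^{(t)}_\mu(\cdot\mid s,a)$ be pmfs on $\mathcal S$, let $r^{(t)}_\mu(s,a)$ be rewards, and let $r^{(T)}_\mu(s)$ be a terminal reward; for all $s,a,s'$ the functions $\mu\mapsto p^{(t)}_\mu(s'\mid s,a)$, $\mu\mapsto r^{(t)}_\mu(s,a)$, $\mu\mapsto r^{(T)}_\mu(s)$, restricted to the pmfs with $\mu(s)>0$, have the smooth extension property. For softmax parameters $\gamma=(\gamma^{(t)}_{z,a})\in\mathbb R^{T|\mathcal Z||\mathcal A|}$ let $\theta(\gamma)^{(t)}_z(a)=e^{\gamma^{(t)}_{z,a}}/\sum_{b}e^{\gamma^{(t)}_{z,b}}$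 and $\pi^{(t)}_\gamma(a\mid s)=\theta(\gamma)^{(t)}_{z(s)}(a)$. Put $\mu^{(0)}_\gamma=\mu^{(0)}$, $\mu^{(t+1)}_\gamma(s')=\sum_{s,a}\mu^{(t)}_\gamma(s)\,\pi^{(t)}_\gamma(a\mid s)\,p^{(t)}_{\mu^{(t)}_\gamma}(s'\mid s,a)$, \[ q_\gamma(s_0,a_0,\dots,a_{T-1},s_T)=\mu^{(0)}(s_0)\prod_{t<T}\pi^{(t)}_\gamma(a_t\mid s_t)\,p^{(t)}_{\mu^{(t)}_\gamma}(s_{t+1}\mid s_t,a_t), \] \[ J_\gamma=\sum_{t<T}\sum_{s,a}\mu^{(t)}_\gamma(s)\,\pi^{(t)}_\gamma(a\mid s)\,r^{(t)}_{\mu^{(t)}_\gamma}(s,a)+\sum_s\mu^{(T)}_\gamma(s)\,r^{(T)}_{\mu^{(T)}_\gamma}(s). \] Let $F(\gamma)=\mathbb E_{q_\gamma}[\nabla_\gamma\log q_\gamma\,(\nabla_\gamma\log q_\gamma)^\top]$ be the Fisher information matrix, and let $\tilde F(\gamma)$ be the block-diagonal matrix whose $t$-th diagonal block is $\mathbb E_{q_\gamma}[\nabla_{\gamma^{(t)}}\log\pi^{(t)}_\gamma(A^{(t)}\mid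 S^{(t)})\,(\nabla_{\gamma^{(t)}}\log\pi^{(t)}_\gamma(A^{(t)}\mid S^{(t)}))^\top]$. With $\dagger$ the Moore--Penrose inverse, the natural gradient is $\widehat\nabla_\gamma J_\gamma=F(\gamma)^\dagger\nabla_\gamma J_\gamma$ and the approximate natural gradient is $\widetilde\nabla_\gamma J_\gamma=\tilde F(\gamma)^\dagger\nabla_\gamma J_\gamma$. Let $\mathcal U(\gamma)$ be the set of pairs $(t,z)$, $t<T$, with $\mu^{(t)}_\gamma(\mathcal S_z)=0$, and for a pmf $\mu$ let $R^{(t)}_\mu=\{(s,a,s'):\mu(s)>0,\ p^{(t)}_\mu(s'\mid s,a)>0\}$. \textbf{Theorem.} Let $\theta^*$ be a pure policy, that is, each $\theta^{*(t)}_z$ is a pmf on $\mathcal A$ supported on a single action. Let $\gamma_n$ be softmax parameters with $\sum_a(\gamma_n)^{(t)}_{z,a}=0$ for all $t,z$ and with $\theta(\gamma_n)\to\theta^*$, and let $\mu^{(t)}_*=\lim_{n\to\infty}\mu^{(t)}_{\gamma_n}$ for $t=0,\dots,T$. Suppose that \begin{enumerate} \item for all large $n$, the set $\mathcal U(\gamma_n)$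 is independent of $n$, and the null space of $F(\gamma_n)$ is a fixed subspace of dimension $T|\mathcal Z|+(|\mathcal A|-1)\,|\mathcal U(\gamma_n)|$; \item for every $t=0,\dots,T$, the set $\{s:\mu^{(t)}_{\gamma_n}(s)>0\}$ equals $\{s:\mu^{(t)}_*(s)>0\}$ for all large $n$; \item for every $t=0,\dots,T-1$, the set $R^{(t)}_{\mu^{(t)}_{\gamma_n}}$ equals $R^{(t)}_{\mu^{(t)}_*}$ for all large $n$; \item for all large $n$, every $t=0,\dots,T$, every $a$, and every $s$ with $\mu^{(t)}_{\gamma_n}(s)=0$, the reward at $s$ (that is, $r^{(t)}_{\mu^{(t)}_\gamma}(s,a)$ if $t<T$, and $r^{(T)}_{\mu^{(T)}_\gamma}(s)$ if $t=T$) is bounded over all $\gamma$ in some neighbourhood of $\gamma_n$ with $\mu^{(t)}_\gamma(s)>0$. (This holds, for example, whenever the rewards are bounded.) \end{enumerate} Then $J$ is differentiable at $\gamma_n$ for all large $n$, and \[ \lim_{n\to\infty}\bigl\|\widehat\nabla_\gamma J_{\gamma_n}-\widetilde\nabla_\gamma J_{\gamma_n}\bigr\|=0 . \] -/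

import Mathlib

open Filter Topology

noncomputable section

/-! Moore-Penrose inverse of a real matrix. -/

/-- The four Penrose equations: `X` is the Moore-Penrose inverse of the real matrix `A`. -/
structure IsMoorePenroseInverse {m n : Type*} [Fintype m] [Fintype n]
    (A : Matrix m n ℝ) (X : Matrix n m ℝ) : Prop where
  mul_mul_self : A * X * A = A
  mul_self_mul : X * A * X = X
  left_symm : (A * X).transpose = A * X
  right_symm : (X * A).transpose = X * A

theorem exists_isMoorePenroseInverse_of_symm {n : Type*} [Fintype n]
    (H : Matrix n n ℝ) (hH : H.transpose = H) :
    ∃ X, IsMoorePenroseInverse H X := by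
  classical
  have hA : H.IsHermitian := by
    simpa [Matrix.IsHermitian, Matrix.conjTranspose_eq_transpose_of_trivial] using hH
  obtain ⟨U, D, hUU, hD⟩ : ∃ (U : Matrix n n ℝ) (d : n → ℝ),
      U.transpose * U = 1 ∧ H = U * Matrix.diagonal d * U.transpose := by
    refine ⟨hA.eigenvectorUnitary, hA.eigenvalues, ?_, ?_⟩
    · have h := (Matrix.mem_unitaryGroup_iff').1 hA.eigenvectorUnitary.2
      simpa [Matrix.star_eq_conjTranspose,
        Matrix.conjTranspose_eq_transpose_of_trivial] using h
    · have h := hA.spectral_theorem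
      rw [Unitary.conjStarAlgAut_apply] at h
      simpa [Matrix.star_eq_conjTranspose,
        Matrix.conjTranspose_eq_transpose_of_trivial, Function.comp_def] using h
  have key : ∀ d e : n → ℝ, (U * Matrix.diagonal d * U.transpose) *
      (U * Matrix.diagonal e * U.transpose) =
      U * Matrix.diagonal (fun i => d i * e i) * U.transpose := by
    intro d e
    calc _ = U * Matrix.diagonal d * (U.transpose * U) * Matrix.diagonal e * U.transpose := by
          simp only [Matrix.mul_assoc]
      _ = _ := by
          rw [hUU, Matrix.mul_one, Matrix.mul_assoc U, Matrix.diagonal_mul_diagonal]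
  have symm : ∀ d : n → ℝ, (U * Matrix.diagonal d * U.transpose).transpose =
      U * Matrix.diagonal d * U.transpose := by
    intro d
    simp [Matrix.transpose_mul, Matrix.mul_assoc]
  refine ⟨U * Matrix.diagonal (fun i => (D i)⁻¹) * U.transpose, ?_, ?_, ?_, ?_⟩
  · rw [hD, key, key]; congr 3; funext i; exact mul_inv_mul_cancel (D i)
  · rw [hD, key, key]; congr 3; funext i
    by_cases h : D i = 0 <;> simp [h]
  · rw [hD, key, symm]
  · rw [hD, key, symm]

/-- Every real matrix has a Moore-Penrose inverse. -/
theorem exists_isMoorePenroseInverse {m n : Type*} [Fintype m] [Fintype n]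
    (A : Matrix m n ℝ) : ∃ X, IsMoorePenroseInverse A X := by
  obtain ⟨Y, hY⟩ := exists_isMoorePenroseInverse_of_symm (A.transpose * A)
    (by simp [Matrix.transpose_mul])
  have hcancel : A * Y * (A.transpose * A) = A := by
    have h0 : (A * Y * (A.transpose * A) - A).conjTranspose *
        (A * Y * (A.transpose * A) - A) = 0 := by
      have h1 : A.transpose * (A * Y * (A.transpose * A) - A) = 0 := by
        have := hY.mul_mul_self
        rw [Matrix.mul_sub, sub_eq_zero]
        simpa only [Matrix.mul_assoc] using this
      rw [Matrix.conjTranspose_eq_transpose_of_trivial, Matrix.transpose_sub,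
        Matrix.mul_assoc A Y, Matrix.transpose_mul, Matrix.sub_mul, Matrix.mul_assoc _ A.transpose]
      rw [Matrix.mul_assoc A Y] at h1
      rw [h1]; simp
    exact sub_eq_zero.1 (Matrix.conjTranspose_mul_self_eq_zero.1 h0)
  refine ⟨Y * A.transpose, ?_, ?_, ?_, ?_⟩
  · simpa only [Matrix.mul_assoc] using hcancel
  · have := congrArg (· * A.transpose) hY.mul_self_mul
    simpa only [Matrix.mul_assoc] using this
  · have hX : A * (Y * A.transpose) = A * Y * (A * Y * (A.transpose * A)).transpose := by
      rw [hcancel, Matrix.mul_assoc]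
    rw [hX]
    simp only [Matrix.transpose_mul, Matrix.transpose_transpose, Matrix.mul_assoc]
  · have := hY.right_symm
    simpa only [Matrix.mul_assoc] using this

/-- The Moore-Penrose inverse is unique. -/
theorem IsMoorePenroseInverse.unique {m n : Type*} [Fintype m] [Fintype n]
    {A : Matrix m n ℝ} {X Y : Matrix n m ℝ}
    (hX : IsMoorePenroseInverse A X) (hY : IsMoorePenroseInverse A Y) : X = Y := by
  have h1 : A * X = A * Y := by
    calc A * X = (A * X).transpose := hX.left_symm.symm
      _ = (A * Y * (A * X)).transpose := by rw [← Matrix.mul_assoc, hY.mul_mul_self]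
      _ = A * X * (A * Y) := by rw [Matrix.transpose_mul, hX.left_symm, hY.left_symm]
      _ = A * Y := by rw [← Matrix.mul_assoc, hX.mul_mul_self]
  have h2 : X * A = Y * A := by
    calc X * A = (X * A).transpose := hX.right_symm.symm
      _ = (X * A * (Y * A)).transpose := by
          rw [Matrix.mul_assoc, ← Matrix.mul_assoc A, hY.mul_mul_self]
      _ = Y * A * (X * A) := by rw [Matrix.transpose_mul, hX.right_symm, hY.right_symm]
      _ = Y * A := by rw [Matrix.mul_assoc, ← Matrix.mul_assoc A, hX.mul_mul_self]
  calc X = X * A * X := hX.mul_self_mul.symm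
    _ = Y * A * Y := by rw [h2, Matrix.mul_assoc, h1, ← Matrix.mul_assoc]
    _ = Y := hY.mul_self_mul

/-- The Moore-Penrose inverse of a real matrix. -/
def pinv {m n : Type*} [Fintype m] [Fintype n] (A : Matrix m n ℝ) : Matrix n m ℝ :=
  Classical.choose (exists_isMoorePenroseInverse A)

theorem pinv_spec {m n : Type*} [Fintype m] [Fintype n] (A : Matrix m n ℝ) :
    IsMoorePenroseInverse A (pinv A) :=
  Classical.choose_spec (exists_isMoorePenroseInverse A)

/-! Gradients and the smooth extension property. -/

/-- The gradient of `f` at `x` in ordinary coordinates (the vector of partial derivatives). -/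
def grad {ι : Type*} [Fintype ι] [DecidableEq ι] (f : (ι → ℝ) → ℝ) (x : ι → ℝ) : ι → ℝ :=
  fun i => fderiv ℝ f x (Pi.single i 1)

/-- `f` has the smooth extension property on the convex set `D`: it extends continuously to a
function that is continuously differentiable on an open neighbourhood `U` of the relative interior
of `D`, and the derivative of this extension extends by continuity to all points of `D`. -/
def HasSmoothExtension {E : Type*} [NormedAddCommGroup E] [NormedSpace ℝ E]
    (D : Set E) (f : E → ℝ) : Prop :=
  ∃ (U : Set E) (g : E → ℝ) (g' : E → E →L[ℝ] ℝ),
    IsOpen U ∧ intrinsicInterior ℝ D ⊆ U ∧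
    (∀ x ∈ D, g x = f x) ∧ ContinuousOn g (U ∪ D) ∧
    ContDiffOn ℝ 1 g U ∧
    (∀ x ∈ U, g' x = fderiv ℝ g x) ∧ ContinuousOn g' (U ∪ D)

/-- The pmfs on `S` that charge the state `s`. -/
def pmfsCharging {S : Type*} [Fintype S] (s : S) : Set (S → ℝ) :=
  {μ | μ ∈ stdSimplex ℝ S ∧ 0 < μ s}

/-! Nonlinear Markov decision problems. -/

/-- The environment of a nonlinear Markov decision problem with state space `S`, action space `A`
and horizon `T`: transition probabilities `trans t μ s a s'` and rewards that depend on the pmf `μ`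
of the current state, with the standing smoothness assumptions. Only values at pmfs `μ` matter. -/
structure NonlinearMDP (S A : Type*) [Fintype S] (T : ℕ) where
  /-- `trans t μ s a s'` is the probability of moving from `s` to `s'` under action `a`. -/
  trans : Fin T → (S → ℝ) → S → A → S → ℝ
  /-- The immediate reward. -/
  reward : Fin T → (S → ℝ) → S → A → ℝ
  /-- The terminal reward. -/
  terminalReward : (S → ℝ) → S → ℝ
  trans_mem : ∀ t, ∀ μ ∈ stdSimplex ℝ S, ∀ s a, trans t μ s a ∈ stdSimplex ℝ S
  trans_smooth : ∀ t s a s', HasSmoothExtension (pmfsCharging s) (fun μ => trans t μ s a s')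
  reward_smooth : ∀ t s a, HasSmoothExtension (pmfsCharging s) (fun μ => reward t μ s a)
  terminalReward_smooth :
    ∀ s, HasSmoothExtension (pmfsCharging s) (fun μ => terminalReward μ s)

namespace NonlinearMDP

variable {S A : Type*} [Fintype S] [Fintype A] {T : ℕ}

/-- The state pmf at time `t = 0, …, T` under the policy `π t s a` (the probability of taking
action `a` in state `s` at time `t`), from the initial pmf `μ₀`. -/
def stateDist (M : NonlinearMDP S A T) (μ₀ : S → ℝ) (π : Fin T → S → A → ℝ) :
    Fin (T + 1) → S → ℝ :=
  Fin.induction (motive := fun _ => S → ℝ) μ₀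
    (fun t μ s' => ∑ s, ∑ a, μ s * π t s a * M.trans t μ s a s')

/-- The pmf of the trajectory `(S⁰, A⁰, …, Aᵀ⁻¹, Sᵀ)`; a trajectory is a pair
(states, actions). -/
def trajProb (M : NonlinearMDP S A T) (μ₀ : S → ℝ) (π : Fin T → S → A → ℝ)
    (ω : (Fin (T + 1) → S) × (Fin T → A)) : ℝ :=
  μ₀ (ω.1 0) * ∏ t : Fin T, (π t (ω.1 t.castSucc) (ω.2 t) *
    M.trans t (M.stateDist μ₀ π t.castSucc) (ω.1 t.castSucc) (ω.2 t) (ω.1 t.succ))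

/-- The expected total reward. -/
def value (M : NonlinearMDP S A T) (μ₀ : S → ℝ) (π : Fin T → S → A → ℝ) : ℝ :=
  (∑ t : Fin T, ∑ s, ∑ a, M.stateDist μ₀ π t.castSucc s * π t s a *
      M.reward t (M.stateDist μ₀ π t.castSucc) s a) +
    ∑ s, M.stateDist μ₀ π (Fin.last T) s *
      M.terminalReward (M.stateDist μ₀ π (Fin.last T)) s

/-- The set of transitions `(s, a, s')` from states charged by `μ` with positive probability. -/
def transSupport (M : NonlinearMDP S A T) (t : Fin T) (μ : S → ℝ) : Set (S × A × S) :=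
  {x | 0 < μ x.1 ∧ 0 < M.trans t μ x.1 x.2.1 x.2.2}

end NonlinearMDP

/-! State-partitioned tabular policies in softmax parameters. -/

/-- The state-partitioned tabular policy of `θ`, where `z s` is the expert of state `s`. -/
def tabularPolicy {S A Z : Type*} {T : ℕ} (z : S → Z) (θ : Fin T → Z → A → ℝ) :
    Fin T → S → A → ℝ :=
  fun t s a => θ t (z s) a

/-- `θ` consists of pmfs on `A`, each of which is supported on a single action. -/
def IsPurePolicy {A Z : Type*} [Fintype A] {T : ℕ} (θ : Fin T → Z → A → ℝ) : Prop :=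
  ∀ t z, θ t z ∈ stdSimplex ℝ A ∧ ∃ a, Function.support (θ t z) = {a}

/-- The pmfs obtained from the parameters `γ (t, z, a)` by the softmax transformation. -/
def softmax {A Z : Type*} [Fintype A] {T : ℕ} (γ : Fin T × Z × A → ℝ) : Fin T → Z → A → ℝ :=
  fun t z a => Real.exp (γ (t, z, a)) / ∑ b, Real.exp (γ (t, z, b))

/-- The softmax parameter space: parameters centered for each time and expert. -/
def centeredParams (T : ℕ) (Z A : Type*) [Fintype A] : Set (Fin T × Z × A → ℝ) :=
  {γ | ∀ t z, ∑ a, γ (t, z, a) = 0}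

namespace NonlinearMDP

variable {S A Z : Type*} [Fintype S] [Fintype A] [Fintype Z] {T : ℕ}

/-- The state pmfs as a function of the softmax parameters. -/
def softDist (M : NonlinearMDP S A T) (μ₀ : S → ℝ) (z : S → Z) (γ : Fin T × Z × A → ℝ) :
    Fin (T + 1) → S → ℝ :=
  M.stateDist μ₀ (tabularPolicy z (softmax γ))

/-- The trajectory pmf as a function of the softmax parameters. -/
def softTrajProb (M : NonlinearMDP S A T) (μ₀ : S → ℝ) (z : S → Z) (γ : Fin T × Z × A → ℝ)
    (ω : (Fin (T + 1) → S) × (Fin T → A)) : ℝ :=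
  M.trajProb μ₀ (tabularPolicy z (softmax γ)) ω

/-- The objective as a function of the softmax parameters. -/
def softValue (M : NonlinearMDP S A T) (μ₀ : S → ℝ) (z : S → Z)
    (γ : Fin T × Z × A → ℝ) : ℝ :=
  M.value μ₀ (tabularPolicy z (softmax γ))

variable [DecidableEq Z] [DecidableEq A]

/-- The Fisher information matrix of the trajectory pmf in the softmax parameters. Trajectories
of probability zero have weight zero. -/
def fisher (M : NonlinearMDP S A T) (μ₀ : S → ℝ) (z : S → Z) (γ : Fin T × Z × A → ℝ) :
    Matrix (Fin T × Z × A) (Fin T × Z × A) ℝ :=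
  ∑ ω, M.softTrajProb μ₀ z γ ω •
    Matrix.vecMulVec (grad (fun γ' => Real.log (M.softTrajProb μ₀ z γ' ω)) γ)
      (grad (fun γ' => Real.log (M.softTrajProb μ₀ z γ' ω)) γ)

/-- The score of the action probability at time `t`: the gradient, with respect to the time-`t`
parameters, of the log-probability of action `a` in state `s`. -/
def policyScore (z : S → Z) (γ : Fin T × Z × A → ℝ) (t : Fin T) (s : S) (a : A) : Z × A → ℝ :=
  fun i => grad (fun γ' => Real.log (tabularPolicy z (softmax γ') t s a)) γ (t, i)

/-- The policy function Fisher information matrix at time `t`. -/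
def policyFisher (M : NonlinearMDP S A T) (μ₀ : S → ℝ) (z : S → Z)
    (γ : Fin T × Z × A → ℝ) (t : Fin T) : Matrix (Z × A) (Z × A) ℝ :=
  ∑ ω, M.softTrajProb μ₀ z γ ω •
    Matrix.vecMulVec (policyScore z γ t (ω.1 t.castSucc) (ω.2 t))
      (policyScore z γ t (ω.1 t.castSucc) (ω.2 t))

/-- The block-diagonal approximation of the Fisher information matrix, with the policy function
Fisher information matrices as diagonal blocks. -/
def approxFisher (M : NonlinearMDP S A T) (μ₀ : S → ℝ) (z : S → Z) (γ : Fin T × Z × A → ℝ) :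
    Matrix (Fin T × Z × A) (Fin T × Z × A) ℝ :=
  Matrix.of fun i j => if i.1 = j.1 then M.policyFisher μ₀ z γ i.1 i.2 j.2 else 0

/-- The natural gradient of the objective in the softmax parameters. -/
def naturalGradient (M : NonlinearMDP S A T) (μ₀ : S → ℝ) (z : S → Z)
    (γ : Fin T × Z × A → ℝ) : Fin T × Z × A → ℝ :=
  (pinv (M.fisher μ₀ z γ)).mulVec (grad (M.softValue μ₀ z) γ)

/-- The approximate natural gradient of the objective in the softmax parameters. -/
def approxNaturalGradient (M : NonlinearMDP S A T) (μ₀ : S → ℝ) (z : S → Z)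
    (γ : Fin T × Z × A → ℝ) : Fin T × Z × A → ℝ :=
  (pinv (M.approxFisher μ₀ z γ)).mulVec (grad (M.softValue μ₀ z) γ)

/-- The unreachable time-expert pairs: those for which the states of the expert carry no mass. -/
def unreachable (M : NonlinearMDP S A T) (μ₀ : S → ℝ) (z : S → Z) (γ : Fin T × Z × A → ℝ) :
    Set (Fin T × Z) :=
  {x | ∑ s with z s = x.2, M.softDist μ₀ z γ x.1.castSucc s = 0}

/-- The rewards at the states that are not reached under `γ` stay bounded near `γ`: for each such
state, over those parameters near `γ` under which it is reached. -/
def RewardsBoundedNear (M : NonlinearMDP S A T) (μ₀ : S → ℝ) (z : S → Z)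
    (γ : Fin T × Z × A → ℝ) : Prop :=
  (∀ (t : Fin T) (s : S) (a : A), M.softDist μ₀ z γ t.castSucc s = 0 →
    ∃ C : ℝ, ∀ᶠ γ' in 𝓝 γ, 0 < M.softDist μ₀ z γ' t.castSucc s →
      |M.reward t (M.softDist μ₀ z γ' t.castSucc) s a| ≤ C) ∧
  (∀ s : S, M.softDist μ₀ z γ (Fin.last T) s = 0 →
    ∃ C : ℝ, ∀ᶠ γ' in 𝓝 γ, 0 < M.softDist μ₀ z γ' (Fin.last T) s →
      |M.terminalReward (M.softDist μ₀ z γ' (Fin.last T)) s| ≤ C)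

end NonlinearMDP

end

/-!
Near a pure policy both Fisher matrices degenerate: writing `θ i` for the softmax probability of
the action with index `i = (t, z, a)`, the block of the approximate Fisher matrix `G` at `(t, z)`
is `m * (diag θ - θ θᵀ)`, where `m` is the probability that the expert `z` acts at time `t`
(`approxFisher_mulVec_apply`). Its rows tend to zero at the different rates `θ i`. The proof rests
on the fact that everything else carries the same factors.

Along the coordinate `i` the action probabilities change at rate at most `θ i`. By induction over
time the same holds, up to a constant, for the state distributions, the objective and the logarithms
of the transition probabilities (`exists_norm_fderiv_softDist_le`,
`exists_abs_fderiv_softValue_le`, `exists_abs_transScore_le`). Differentiability up to the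
boundary of the simplex comes from the smooth extension property
(`HasSmoothExtension.exists_hasFDerivWithinAt`); a state that is not charged contributes nothing to
first order, since its probability has a minimum there (`differentiableAt_weighted`). The constants
are uniform along the sequence because the supports stabilize (`exists_eventually_boundedAt`).

Hence the gradient `d` of the objective satisfies `|d i| ≤ C * θ i`, and the Fisher matrix `F`
satisfies `|(F - G) i j| ≤ C * θ i * θ j` (`exists_abs_fisher_sub_approxFisher_le`): the square of
the action score at a single time is accounted for by `G`, and in each of the remaining terms a
factor `θ i` and a factor `θ j` can be split off. The vectors that do not depend on the action, at
the pairs `(t, z)` with `m > 0`, are annihilated by `F`, `G` and `d`. Modulo these, a vector is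
represented by one that vanishes at the actions of the pure policy. On such representatives,
dividing the rows of `G y = r` by `θ i` bounds `y` by `max |r i| / θ i`, while `F - G` is small
relative to `θ i`, because all `θ j` that matter tend to zero. So the natural gradients are
bounded, the null spaces of `F` and `G` agree near the pure policy, and the difference of the
natural gradients is of the order of the distance to the pure policy
(`norm_pinv_mulVec_sub_le`).
-/

/-! ### The smooth extension property on the simplex -/

/-- Pmfs that charge every state lie in the relative interior of `pmfsCharging s`. -/
theorem mem_intrinsicInterior_pmfsCharging {S : Type*} [Fintype S] (s : S) {μ : S → ℝ}
    (hμ : ∑ i, μ i = 1) (hpos : ∀ i, 0 < μ i) :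
    μ ∈ intrinsicInterior ℝ (pmfsCharging s) := by
  have hmem : μ ∈ pmfsCharging s := ⟨⟨fun i => (hpos i).le, hμ⟩, hpos s⟩
  have hspan : ∀ x ∈ affineSpan ℝ (pmfsCharging s), ∑ i, x i = 1 := by
    intro x hx
    refine affineSpan_induction (p := fun x : S → ℝ => ∑ i, x i = 1) hx (fun y hy => hy.1.2) ?_
    intro c u v w hu hv hw
    simp [Finset.sum_add_distrib, ← Finset.mul_sum, hu, hv, hw]
  rw [mem_intrinsicInterior]
  refine ⟨⟨μ, subset_affineSpan ℝ _ hmem⟩, ?_, rfl⟩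
  rw [mem_interior]
  refine ⟨Subtype.val ⁻¹' {x : S → ℝ | ∀ i, 0 < x i}, ?_, ?_, hpos⟩
  · rintro ⟨x, hx⟩ hxpos
    exact ⟨⟨fun i => le_of_lt (hxpos i), hspan x hx⟩, hxpos s⟩
  · refine IsOpen.preimage continuous_subtype_val ?_
    rw [Set.ofPred_forall]
    exact isOpen_iInter_of_finite fun i => isOpen_lt continuous_const (continuous_apply i)

/-- A function with the smooth extension property is differentiable within `pmfsCharging s` at
every point, boundary points included, and the derivative can be chosen continuous. The mean value
inequality holds between points of the relative interior, where the extension is differentiable;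
continuity of the extension and of its derivative carry it over to the boundary. -/
theorem HasSmoothExtension.exists_hasFDerivWithinAt {S : Type*} [Fintype S] {s : S}
    {f : (S → ℝ) → ℝ} (hf : HasSmoothExtension (pmfsCharging s) f) :
    ∃ f' : (S → ℝ) → (S → ℝ) →L[ℝ] ℝ, ContinuousOn f' (pmfsCharging s) ∧
      ∀ μ ∈ pmfsCharging s, HasFDerivWithinAt f (f' μ) (pmfsCharging s) μ := by
  obtain ⟨U, g, g', hU, hsub, hgf, hg, hgU, hg'U, hg'⟩ := hf
  refine ⟨g', hg'.mono Set.subset_union_right, fun x hx => ?_⟩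
  have hgD : ContinuousOn g (pmfsCharging s) := hg.mono Set.subset_union_right
  have hg'D : ContinuousOn g' (pmfsCharging s) := hg'.mono Set.subset_union_right
  have : Nonempty S := ⟨s⟩
  -- segments from a point of `pmfsCharging s` to the uniform pmf run in the relative interior
  let u : S → ℝ := fun _ => (Fintype.card S : ℝ)⁻¹
  have hcard : (0 : ℝ) < Fintype.card S := by exact_mod_cast Fintype.card_pos
  have hu : ∑ i, u i = 1 := by simp [u]
  let m : ℝ → (S → ℝ) → (S → ℝ) := fun τ y => (1 - τ) • y + τ • u
  have hm : ∀ y ∈ pmfsCharging s, ∀ τ ∈ Set.Ioo (0 : ℝ) 1,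
      (∑ i, m τ y i = 1) ∧ ∀ i, 0 < m τ y i := by
    intro y hy τ hτ
    constructor
    · simp [m, Finset.sum_add_distrib, ← Finset.mul_sum, hu, hy.1.2]
    · intro i
      have h1 : 0 ≤ (1 - τ) * y i := mul_nonneg (by linarith [hτ.2]) (hy.1.1 i)
      have h2 : 0 < τ * u i := mul_pos hτ.1 (by simp [u, hcard])
      simpa [m] using add_pos_of_nonneg_of_pos h1 h2
  have hmlim : ∀ y ∈ pmfsCharging s, Tendsto (fun τ => m τ y) (𝓝[>] 0)
      (𝓝[pmfsCharging s] y) := by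
    intro y hy
    refine tendsto_nhdsWithin_iff.2 ⟨?_, ?_⟩
    · have : Continuous fun τ => m τ y := by fun_prop
      have h := (this.tendsto 0).mono_left (nhdsWithin_le_nhds (s := Set.Ioi (0 : ℝ)))
      simpa [m] using h
    · filter_upwards [Ioo_mem_nhdsGT (zero_lt_one' ℝ)] with τ hτ
      obtain ⟨h1, h2⟩ := hm y hy τ hτ
      exact ⟨⟨fun i => (h2 i).le, h1⟩, h2 s⟩
  have key : HasFDerivWithinAt g (g' x) (pmfsCharging s) x := by
    refine HasFDerivWithinAt.of_isLittleO ?_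
    rw [Asymptotics.isLittleO_iff]
    intro ε hε
    obtain ⟨δ, hδ, hball⟩ := Metric.continuousWithinAt_iff.1 (hg'D x hx) ε hε
    filter_upwards [self_mem_nhdsWithin,
      mem_nhdsWithin_of_mem_nhds (Metric.ball_mem_nhds x hδ)] with y hy hyx
    let B : Set (S → ℝ) := {w | (∑ i, w i = 1) ∧ ∀ i, 0 < w i} ∩ Metric.ball x δ
    have hBconv : Convex ℝ B := by
      refine Convex.inter ?_ (convex_ball x δ)
      intro a ha b hb p q hp hq hpq
      refine ⟨by simp [Finset.sum_add_distrib, ← Finset.mul_sum, ha.1, hb.1, hpq], fun i => ?_⟩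
      exact (convex_Ioi (0 : ℝ)) (ha.2 i) (hb.2 i) hp hq hpq
    have hBD : ∀ w ∈ B, w ∈ pmfsCharging s := fun w hw =>
      ⟨⟨fun i => (hw.1.2 i).le, hw.1.1⟩, hw.1.2 s⟩
    have hBU : ∀ w ∈ B, w ∈ U := fun w hw =>
      hsub (mem_intrinsicInterior_pmfsCharging s hw.1.1 hw.1.2)
    have hder : ∀ w ∈ B, HasFDerivWithinAt g (g' w) B w := by
      intro w hw
      rw [hg'U w (hBU w hw)]
      exact ((hgU.differentiableOn one_ne_zero).differentiableAt
        (hU.mem_nhds (hBU w hw))).hasFDerivAt.hasFDerivWithinAt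
    have hbound : ∀ w ∈ B, ‖g' w - g' x‖ ≤ ε := by
      intro w hw
      rw [← dist_eq_norm]
      exact (hball (hBD w hw) hw.2).le
    have hev : ∀ v ∈ pmfsCharging s, v ∈ Metric.ball x δ → ∀ᶠ τ in 𝓝[>] (0 : ℝ), m τ v ∈ B := by
      intro v hv hvx
      have h1 := (hmlim v hv).mono_right nhdsWithin_le_nhds
      filter_upwards [Ioo_mem_nhdsGT (zero_lt_one' ℝ),
        h1.eventually (Metric.isOpen_ball.mem_nhds hvx)] with τ hτ h2
      exact ⟨hm v hv τ hτ, h2⟩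
    have hineq : ∀ᶠ τ in 𝓝[>] (0 : ℝ),
        ‖g (m τ y) - g (m τ x) - g' x (m τ y - m τ x)‖ ≤ ε * ‖m τ y - m τ x‖ := by
      filter_upwards [hev y hy hyx, hev x hx (Metric.mem_ball_self hδ)] with τ h1 h2
      exact Convex.norm_image_sub_le_of_norm_hasFDerivWithin_le' hder hbound hBconv h2 h1
    have hy' := hmlim y hy
    have hx' := hmlim x hx
    have hd := (hy'.mono_right nhdsWithin_le_nhds).sub (hx'.mono_right nhdsWithin_le_nhds)
    exact le_of_tendsto_of_tendsto
      ((((hgD y hy).tendsto.comp hy').sub ((hgD x hx).tendsto.comp hx')).sub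
        (((g' x).continuous.tendsto _).comp hd)).norm
      (hd.norm.const_mul ε) hineq
  exact key.congr (fun y hy => (hgf y hy).symm) (hgf x hx).symm

/-- At the pmf `μ`, the function `f` is bounded by `K` and has a derivative of norm at most `K`
within the pmfs that charge `s`. Such derivatives need not be unique as linear maps on the ambient
space, hence the existential quantifier in place of `fderivWithin`. -/
def RegularAt {S : Type*} [Fintype S] (K : ℝ) (s : S) (f : (S → ℝ) → ℝ) (μ : S → ℝ) : Prop :=
  |f μ| ≤ K ∧ ∃ f' : (S → ℝ) →L[ℝ] ℝ,
    HasFDerivWithinAt f f' (pmfsCharging s) μ ∧ ‖f'‖ ≤ K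

theorem RegularAt.mono {S : Type*} [Fintype S] {K L : ℝ} (hKL : K ≤ L) {s : S}
    {f : (S → ℝ) → ℝ} {μ : S → ℝ} (h : RegularAt K s f μ) : RegularAt L s f μ := by
  obtain ⟨h1, f', h2, h3⟩ := h
  exact ⟨h1.trans hKL, f', h2, h3.trans hKL⟩

/-- Regularity is uniform along a sequence of pmfs whose limit charges `s`. -/
theorem HasSmoothExtension.eventually_regularAt {S ι : Type*} [Fintype S] {s : S}
    {f : (S → ℝ) → ℝ} (hf : HasSmoothExtension (pmfsCharging s) f) {l : Filter ι}
    {m : ι → S → ℝ} {μ : S → ℝ} (hμ : μ ∈ pmfsCharging s) (hm : Tendsto m l (𝓝 μ))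
    (hmem : ∀ᶠ n in l, m n ∈ pmfsCharging s) :
    ∃ K, ∀ᶠ n in l, RegularAt K s f (m n) := by
  obtain ⟨f', hcont, hder⟩ := hf.exists_hasFDerivWithinAt
  have hw : Tendsto m l (𝓝[pmfsCharging s] μ) := tendsto_nhdsWithin_iff.2 ⟨hm, hmem⟩
  have h1 := ((hder μ hμ).continuousWithinAt.tendsto.comp hw).abs
  have h2 := ((hcont μ hμ).tendsto.comp hw).norm
  refine ⟨max (|f μ| + 1) (‖f' μ‖ + 1), ?_⟩
  filter_upwards [hmem, h1.eventually (ge_mem_nhds (lt_add_one _)),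
    h2.eventually (ge_mem_nhds (lt_add_one _))] with n hn ha hb
  exact ⟨ha.trans (le_max_left _ _), f' (m n), hder _ hn, hb.trans (le_max_right _ _)⟩

theorem HasSmoothExtension.exists_regularAt {S : Type*} [Fintype S] {s : S}
    {f : (S → ℝ) → ℝ} (hf : HasSmoothExtension (pmfsCharging s) f) {μ : S → ℝ}
    (hμ : μ ∈ pmfsCharging s) : ∃ K, RegularAt K s f μ := by
  obtain ⟨f', -, hder⟩ := hf.exists_hasFDerivWithinAt
  exact ⟨max |f μ| ‖f' μ‖, le_max_left _ _, f' μ, hder μ hμ, le_max_right _ _⟩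

/-! ### Softmax policies -/

section Softmax

variable {A Z : Type*} [Fintype A] {T : ℕ}

theorem softmax_pos [Nonempty A] (γ : Fin T × Z × A → ℝ) (t : Fin T) (z : Z) (a : A) :
    0 < softmax γ t z a :=
  div_pos (Real.exp_pos _) (Finset.sum_pos (fun _ _ => Real.exp_pos _) Finset.univ_nonempty)

theorem sum_softmax [Nonempty A] (γ : Fin T × Z × A → ℝ) (t : Fin T) (z : Z) :
    ∑ a, softmax γ t z a = 1 := by
  have h : (0 : ℝ) < ∑ b, Real.exp (γ (t, z, b)) :=
    Finset.sum_pos (fun _ _ => Real.exp_pos _) Finset.univ_nonempty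
  simp only [softmax, ← Finset.sum_div]
  exact div_self h.ne'

theorem softmax_le_one [Nonempty A] (γ : Fin T × Z × A → ℝ) (t : Fin T) (z : Z) (a : A) :
    softmax γ t z a ≤ 1 := by
  rw [← sum_softmax γ t z]
  exact Finset.single_le_sum (fun b _ => (softmax_pos γ t z b).le) (Finset.mem_univ a)

variable [Fintype Z]

theorem hasFDerivAt_softmax [Nonempty A] (γ : Fin T × Z × A → ℝ) (t : Fin T) (z : Z) (a : A) :
    HasFDerivAt (fun γ' : Fin T × Z × A → ℝ => softmax γ' t z a)
      (softmax γ t z a • (ContinuousLinearMap.proj (R := ℝ) (φ := fun _ : Fin T × Z × A => ℝ)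
        (t, z, a) - ∑ b, softmax γ t z b •
          ContinuousLinearMap.proj (R := ℝ) (φ := fun _ : Fin T × Z × A => ℝ) (t, z, b))) γ := by
  have hpos : (0 : ℝ) < ∑ b, Real.exp (γ (t, z, b)) :=
    Finset.sum_pos (fun _ _ => Real.exp_pos _) Finset.univ_nonempty
  have he : ∀ b, HasFDerivAt (fun γ' : Fin T × Z × A → ℝ => Real.exp (γ' (t, z, b)))
      (Real.exp (γ (t, z, b)) •
        ContinuousLinearMap.proj (R := ℝ) (φ := fun _ : Fin T × Z × A => ℝ) (t, z, b)) γ :=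
    fun b => (ContinuousLinearMap.proj (R := ℝ) (φ := fun _ : Fin T × Z × A => ℝ)
      (t, z, b)).hasFDerivAt.exp
  have hs := HasFDerivAt.fun_sum (u := Finset.univ) fun b _ => he b
  have h := (he a).mul ((hasDerivAt_inv hpos.ne').comp_hasFDerivAt γ hs)
  refine (h.congr_fderiv ?_).congr_of_eventuallyEq (Eventually.of_forall fun γ' => ?_)
  · ext v
    simp only [softmax, add_apply, smul_apply,
      sub_apply, sum_apply, ContinuousLinearMap.proj_apply,
      smul_eq_mul, div_mul_eq_mul_div, ← Finset.sum_div]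
    simp
    field_simp
    ring
  · simp [softmax, div_eq_mul_inv]

theorem fderiv_softmax_apply [Nonempty A] (γ v : Fin T × Z × A → ℝ) (t : Fin T) (z : Z) (a : A) :
    fderiv ℝ (fun γ' : Fin T × Z × A → ℝ => softmax γ' t z a) γ v =
      softmax γ t z a * (v (t, z, a) - ∑ b, softmax γ t z b * v (t, z, b)) := by
  rw [(hasFDerivAt_softmax γ t z a).fderiv]
  simp

theorem fderiv_log_softmax_apply [Nonempty A] (γ v : Fin T × Z × A → ℝ) (t : Fin T) (z : Z)
    (a : A) :
    fderiv ℝ (fun γ' : Fin T × Z × A → ℝ => Real.log (softmax γ' t z a)) γ v =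
      v (t, z, a) - ∑ b, softmax γ t z b * v (t, z, b) := by
  have hpos := softmax_pos γ t z a
  rw [((hasFDerivAt_softmax γ t z a).log hpos.ne').fderiv]
  simp [hpos.ne']

/-- Softmax probabilities are stationary in directions that are constant in the actions. -/
theorem fderiv_softmax_eq_zero [Nonempty A] {γ v : Fin T × Z × A → ℝ} {t : Fin T} {z : Z}
    (hv : ∀ a b, v (t, z, a) = v (t, z, b)) (a : A) :
    fderiv ℝ (fun γ' : Fin T × Z × A → ℝ => softmax γ' t z a) γ v = 0 := by
  rw [fderiv_softmax_apply, Finset.sum_congr rfl fun b _ => by rw [hv b a],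
    ← Finset.sum_mul, sum_softmax, one_mul, sub_self, mul_zero]

variable [DecidableEq Z] [DecidableEq A]

/-- The change of a softmax probability along a coordinate is at most the probability of the
corresponding action. -/
theorem abs_fderiv_softmax_single_le [Nonempty A] (γ : Fin T × Z × A → ℝ) (i : Fin T × Z × A)
    (t : Fin T) (z : Z) (a : A) :
    |fderiv ℝ (fun γ' : Fin T × Z × A → ℝ => softmax γ' t z a) γ (Pi.single i 1)| ≤
      softmax γ i.1 i.2.1 i.2.2 := by
  obtain ⟨t', z', a'⟩ := i
  have hp := softmax_pos γ t' z' a'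
  rw [fderiv_softmax_apply]
  by_cases h : t = t' ∧ z = z'
  · obtain ⟨rfl, rfl⟩ := h
    have h1 : ∑ b, softmax γ t z b * (Pi.single (t, z, a') (1 : ℝ) : Fin T × Z × A → ℝ) (t, z, b)
        = softmax γ t z a' := by
      simp [Pi.single_apply]
    have ha := softmax_pos γ t z a
    have ha1 := softmax_le_one γ t z a
    have hp1 := softmax_le_one γ t z a'
    rw [h1]
    by_cases hab : a = a'
    · subst hab
      rw [abs_le]
      constructor <;> simp <;> nlinarith
    · rw [abs_le]
      constructor <;> simp [hab] <;> nlinarith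
  · have h1 : ∀ b, (Pi.single (t', z', a') (1 : ℝ) : Fin T × Z × A → ℝ) (t, z, b) = 0 := by
      intro b
      rw [Pi.single_apply, if_neg]
      rintro ⟨⟩
      exact h ⟨rfl, rfl⟩
    simp [h1, hp.le]

end Softmax

/-! ### Differentiability of state distributions -/

/-- The chain rule for a regular function of a curve of pmfs that charges `s`. -/
theorem RegularAt.comp {E S : Type*} [NormedAddCommGroup E] [NormedSpace ℝ E]
    [Fintype S] {m : E → S → ℝ} (hm : ∀ x, m x ∈ stdSimplex ℝ S) {x : E}
    (hmd : DifferentiableAt ℝ m x) {s : S} {f : (S → ℝ) → ℝ} {K : ℝ} (hpos : 0 < m x s)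
    (hreg : RegularAt K s f (m x)) :
    DifferentiableAt ℝ (fun y => f (m y)) x ∧
    ∀ v, |fderiv ℝ (fun y => f (m y)) x v| ≤ K * ‖fderiv ℝ m x v‖ := by
  obtain ⟨hfK, f', hf', hf'K⟩ := hreg
  have hev : ∀ᶠ y in 𝓝 x, m y ∈ pmfsCharging s := by
    have hms : ContinuousAt (fun y => m y s) x := (differentiableAt_pi.1 hmd s).continuousAt
    filter_upwards [hms.eventually (lt_mem_nhds hpos)] with y hy
    exact ⟨hm y, hy⟩
  have hcomp : HasFDerivAt (fun y => f (m y)) (f' ∘L fderiv ℝ m x) x := by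
    have h1 : HasFDerivWithinAt (fun y => f (m y)) (f' ∘L fderiv ℝ m x)
        {y | m y ∈ pmfsCharging s} x :=
      hf'.comp x hmd.hasFDerivAt.hasFDerivWithinAt fun y hy => hy
    exact h1.hasFDerivAt hev
  refine ⟨hcomp.differentiableAt, fun v => ?_⟩
  rw [hcomp.fderiv]
  exact (f'.le_opNorm _).trans (mul_le_mul_of_nonneg_right hf'K (norm_nonneg _))

/-- The product of a state probability, a weight, and a function of the state pmf is
differentiable, provided that the function is regular where the state is charged, and bounded
nearby where it is not. In the second case the state probability has a minimum, so that it vanishes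
to first order. The derivative is bounded in terms of those of the factors. -/
theorem differentiableAt_weighted {E S : Type*} [NormedAddCommGroup E] [NormedSpace ℝ E]
    [Fintype S] {m : E → S → ℝ} (hm : ∀ x, m x ∈ stdSimplex ℝ S) {x : E}
    (hmd : DifferentiableAt ℝ m x) {w : E → ℝ} (hwd : DifferentiableAt ℝ w x)
    (s : S) {f : (S → ℝ) → ℝ}
    (hbdd : m x s = 0 → ∃ C : ℝ, ∀ᶠ y in 𝓝 x, 0 < m y s → |f (m y)| ≤ C)
    {K : ℝ} (hreg : 0 < m x s → RegularAt K s f (m x)) :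
    DifferentiableAt ℝ (fun y => m y s * w y * f (m y)) x ∧
    (|w x| ≤ 1 → ∀ (v : E) (b c : ℝ), ‖fderiv ℝ m x v‖ ≤ b → (0 < m x s → |fderiv ℝ w x v| ≤ c) →
      0 ≤ c → 0 ≤ K → |fderiv ℝ (fun y => m y s * w y * f (m y)) x v| ≤ K * (2 * b + c)) := by
  have hms : DifferentiableAt ℝ (fun y => m y s) x := differentiableAt_pi.1 hmd s
  rcases (hm x).1 s |>.eq_or_lt with h0 | hpos
  · obtain ⟨C, hC⟩ := hbdd h0.symm
    have hmin : IsLocalMin (fun y => m y s) x := by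
      refine Eventually.of_forall fun y => ?_
      simpa [← h0] using (hm y).1 s
    have hzero : HasFDerivAt (fun y => m y s) (0 : E →L[ℝ] ℝ) x := by
      have := hms.hasFDerivAt
      rwa [hmin.fderiv_eq_zero] at this
    have hlittle : (fun y => m y s) =o[𝓝 x] fun y => y - x := by
      have := hzero.isLittleO
      simpa [← h0] using this
    have hO : (fun y => m y s * w y * f (m y)) =O[𝓝 x] fun y => m y s := by
      obtain ⟨B, hB⟩ : ∃ B : ℝ, ∀ᶠ y in 𝓝 x, |w y| ≤ B :=
        ⟨|w x| + 1, (hwd.continuousAt.abs.eventually (ge_mem_nhds (lt_add_one _)))⟩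
      refine Asymptotics.IsBigO.of_bound (B * C) ?_
      filter_upwards [hC, hB] with y hy hBy
      rcases ((hm y).1 s).eq_or_lt with h | h
      · simp [← h]
      · have h1 := hy h
        simp only [norm_mul, Real.norm_eq_abs]
        have hB0 : 0 ≤ B := (abs_nonneg _).trans hBy
        calc |m y s| * |w y| * |f (m y)| ≤ |m y s| * B * C := by gcongr
          _ = B * C * |m y s| := by ring
    have hder : HasFDerivAt (fun y => m y s * w y * f (m y)) (0 : E →L[ℝ] ℝ) x := by
      refine HasFDerivAt.of_isLittleO ?_
      have := hO.trans_isLittleO hlittle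
      simpa [← h0] using this
    refine ⟨hder.differentiableAt, fun _ v b c hb _ hc hK => ?_⟩
    rw [hder.fderiv]
    have hb0 : 0 ≤ b := (norm_nonneg _).trans hb
    simp only [zero_apply, abs_zero]
    positivity
  · have hfK := (hreg hpos).1
    obtain ⟨hfd, hfb⟩ := (hreg hpos).comp hm hmd hpos
    have hd := (hms.hasFDerivAt.mul hwd.hasFDerivAt).mul hfd.hasFDerivAt
    refine ⟨hd.differentiableAt, fun hw1 v b c hb hc hc0 hK => ?_⟩
    have hprod : fderiv ℝ (fun y => m y s * w y * f (m y)) x =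
      (m x s * w x) • fderiv ℝ (fun y => f (m y)) x + f (m x) • (m x s • fderiv ℝ w x +
        w x • fderiv ℝ (fun y => m y s) x) := hd.fderiv
    rw [hprod]
    have hms1 : |m x s| ≤ 1 := by
      rw [abs_of_pos hpos, ← (hm x).2]
      exact Finset.single_le_sum (fun i _ => (hm x).1 i) (Finset.mem_univ s)
    have hmv : |fderiv ℝ (fun y => m y s) x v| ≤ b := by
      have h1 : fderiv ℝ (fun y => m y s) x v = fderiv ℝ m x v s := by
        rw [fderiv_apply hmd]
        rfl
      rw [h1]
      exact (norm_le_pi_norm (fderiv ℝ m x v) s).trans hb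
    have hfv : |fderiv ℝ (fun y => f (m y)) x v| ≤ K * b := (hfb v).trans (by gcongr)
    have hb0 : 0 ≤ b := (norm_nonneg _).trans hb
    have hwv := hc hpos
    simp only [add_apply, smul_apply, smul_eq_mul]
    calc _ ≤ |m x s| * |w x| * |fderiv ℝ (fun y => f (m y)) x v| + |f (m x)| *
          (|m x s| * |fderiv ℝ w x v| + |w x| * |fderiv ℝ (fun y => m y s) x v|) := by
          refine (abs_add_le _ _).trans ?_
          rw [abs_mul, abs_mul, abs_mul (f (m x))]
          gcongr
          refine (abs_add_le _ _).trans ?_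
          rw [abs_mul, abs_mul]
      _ ≤ 1 * 1 * (K * b) + K * (1 * c + 1 * b) := by gcongr
      _ = K * (2 * b + c) := by ring

namespace NonlinearMDP

section Dist

variable {S A Z : Type*} [Fintype S] [Fintype A] {T : ℕ}
  (M : NonlinearMDP S A T) (μ₀ : S → ℝ) (z : S → Z)

theorem softDist_zero (γ : Fin T × Z × A → ℝ) : M.softDist μ₀ z γ 0 = μ₀ := rfl

theorem softDist_succ (γ : Fin T × Z × A → ℝ) (t : Fin T) (s' : S) :
    M.softDist μ₀ z γ t.succ s' = ∑ s, ∑ a, M.softDist μ₀ z γ t.castSucc s *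
      softmax γ t (z s) a * M.trans t (M.softDist μ₀ z γ t.castSucc) s a s' := rfl

variable {μ₀}

theorem softDist_mem_stdSimplex [Nonempty A] (hμ₀ : μ₀ ∈ stdSimplex ℝ S)
    (γ : Fin T × Z × A → ℝ) (t : Fin (T + 1)) : M.softDist μ₀ z γ t ∈ stdSimplex ℝ S := by
  induction t using Fin.induction with
  | zero => exact hμ₀
  | succ t ih =>
    have hp := M.trans_mem t _ ih
    constructor
    · intro s'
      rw [softDist_succ]
      exact Finset.sum_nonneg fun s _ => Finset.sum_nonneg fun a _ =>
        mul_nonneg (mul_nonneg (ih.1 s) (softmax_pos γ t (z s) a).le) ((hp s a).1 s')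
    · simp only [softDist_succ]
      rw [Finset.sum_comm, ← ih.2]
      refine Finset.sum_congr rfl fun s _ => ?_
      rw [Finset.sum_comm]
      simp only [← Finset.mul_sum, (hp s _).2, mul_one, sum_softmax]

theorem trans_le_one [Nonempty A] (hμ₀ : μ₀ ∈ stdSimplex ℝ S) (γ : Fin T × Z × A → ℝ)
    (t : Fin T) (s : S) (a : A) (s' : S) :
    M.trans t (M.softDist μ₀ z γ t.castSucc) s a s' ≤ 1 := by
  have h := M.trans_mem t _ (M.softDist_mem_stdSimplex z hμ₀ γ t.castSucc) s a
  rw [← h.2]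
  exact Finset.single_le_sum (fun i _ => h.1 i) (Finset.mem_univ s')

theorem abs_trans_le_one [Nonempty A] (hμ₀ : μ₀ ∈ stdSimplex ℝ S) (γ : Fin T × Z × A → ℝ)
    (t : Fin T) (s : S) (a : A) (s' : S) :
    |M.trans t (M.softDist μ₀ z γ t.castSucc) s a s'| ≤ 1 := by
  rw [abs_of_nonneg]
  · exact M.trans_le_one z hμ₀ γ t s a s'
  · exact (M.trans_mem t _ (M.softDist_mem_stdSimplex z hμ₀ γ t.castSucc) s a).1 s'

theorem softValue_eq (γ : Fin T × Z × A → ℝ) : M.softValue μ₀ z γ =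
    (∑ t : Fin T, ∑ s, ∑ a, M.softDist μ₀ z γ t.castSucc s * softmax γ t (z s) a *
      M.reward t (M.softDist μ₀ z γ t.castSucc) s a) +
    ∑ s, M.softDist μ₀ z γ (Fin.last T) s * 1 *
      M.terminalReward (M.softDist μ₀ z γ (Fin.last T)) s := by
  simp only [mul_one]
  rfl

variable [Fintype Z]

/-- The state distributions are differentiable at all softmax parameters: transition
probabilities out of uncharged states may be discontinuous, but they are bounded. -/
theorem differentiableAt_softDist [Nonempty A] (hμ₀ : μ₀ ∈ stdSimplex ℝ S)
    (γ : Fin T × Z × A → ℝ) (t : Fin (T + 1)) :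
    DifferentiableAt ℝ (fun γ' => M.softDist μ₀ z γ' t) γ := by
  induction t using Fin.induction with
  | zero => exact differentiableAt_const μ₀
  | succ t ih =>
    refine differentiableAt_pi.2 fun s' => ?_
    simp only [softDist_succ]
    refine DifferentiableAt.fun_sum fun s _ => DifferentiableAt.fun_sum fun a _ => ?_
    by_cases hpos : 0 < M.softDist μ₀ z γ t.castSucc s
    · obtain ⟨K, hK⟩ := (M.trans_smooth t s a s').exists_regularAt
        ⟨M.softDist_mem_stdSimplex z hμ₀ γ t.castSucc, hpos⟩
      exact (differentiableAt_weighted (fun γ' => M.softDist_mem_stdSimplex z hμ₀ γ' t.castSucc)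
        ih (hasFDerivAt_softmax γ t (z s) a).differentiableAt s
        (f := fun μ => M.trans t μ s a s')
        (fun _ => ⟨1, Eventually.of_forall fun γ' _ => M.abs_trans_le_one z hμ₀ γ' t s a s'⟩)
        fun _ => hK).1
    · exact (differentiableAt_weighted (fun γ' => M.softDist_mem_stdSimplex z hμ₀ γ' t.castSucc)
        ih (hasFDerivAt_softmax γ t (z s) a).differentiableAt s
        (f := fun μ => M.trans t μ s a s') (K := 0)
        (fun _ => ⟨1, Eventually.of_forall fun γ' _ => M.abs_trans_le_one z hμ₀ γ' t s a s'⟩)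
        fun h => absurd h hpos).1

variable (μ₀)

/-- A bound `K` on all quantities that enter the derivatives of the state distributions, the
log-likelihood and the objective at `γ`: values and derivatives of transition probabilities and
rewards at charged states, and inverses of positive state and transition probabilities. -/
structure BoundedAt (K : ℝ) (γ : Fin T × Z × A → ℝ) : Prop where
  nonneg : 0 ≤ K
  trans : ∀ t s, 0 < M.softDist μ₀ z γ t.castSucc s → ∀ a s',
    RegularAt K s (fun μ => M.trans t μ s a s') (M.softDist μ₀ z γ t.castSucc)
  reward : ∀ t s, 0 < M.softDist μ₀ z γ t.castSucc s → ∀ a,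
    RegularAt K s (fun μ => M.reward t μ s a) (M.softDist μ₀ z γ t.castSucc)
  terminalReward : ∀ s, 0 < M.softDist μ₀ z γ (Fin.last T) s →
    RegularAt K s (fun μ => M.terminalReward μ s) (M.softDist μ₀ z γ (Fin.last T))
  one_le_dist : ∀ (t : Fin T) s, 0 < M.softDist μ₀ z γ t.castSucc s →
    1 ≤ K * M.softDist μ₀ z γ t.castSucc s
  one_le_trans : ∀ (t : Fin T) s, 0 < M.softDist μ₀ z γ t.castSucc s → ∀ a s',
    0 < M.trans t (M.softDist μ₀ z γ t.castSucc) s a s' →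
    1 ≤ K * M.trans t (M.softDist μ₀ z γ t.castSucc) s a s'

/-- The action probabilities at charged states change along `v` at rate at most `b`. With `b = 0`
this singles out the directions in which the objective and the likelihoods are stationary. -/
def PolicyRateLE (γ v : Fin T × Z × A → ℝ) (b : ℝ) : Prop :=
  ∀ t s, 0 < M.softDist μ₀ z γ t.castSucc s → ∀ a,
    |fderiv ℝ (fun γ' : Fin T × Z × A → ℝ => softmax γ' t (z s) a) γ v| ≤ b

variable {μ₀}

/-- The state distributions change at most in proportion to the action probabilities. -/
theorem exists_norm_fderiv_softDist_le [Nonempty A] (hμ₀ : μ₀ ∈ stdSimplex ℝ S) (K : ℝ) :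
    ∃ C, 0 ≤ C ∧ ∀ γ, M.BoundedAt μ₀ z K γ → ∀ v b, 0 ≤ b → M.PolicyRateLE μ₀ z γ v b → ∀ t,
      ‖fderiv ℝ (fun γ' => M.softDist μ₀ z γ' t) γ v‖ ≤ C * b := by
  suffices h : ∀ t : Fin (T + 1), ∃ C, 0 ≤ C ∧ ∀ γ, M.BoundedAt μ₀ z K γ → ∀ v b, 0 ≤ b →
      M.PolicyRateLE μ₀ z γ v b →
      ‖fderiv ℝ (fun γ' => M.softDist μ₀ z γ' t) γ v‖ ≤ C * b by
    choose C hC0 hC using h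
    refine ⟨∑ t, C t, Finset.sum_nonneg fun t _ => hC0 t, fun γ hγ v b hb hv t => ?_⟩
    refine (hC t γ hγ v b hb hv).trans ?_
    gcongr
    exact Finset.single_le_sum (fun i _ => hC0 i) (Finset.mem_univ t)
  intro t
  induction t using Fin.induction with
  | zero =>
    refine ⟨0, le_rfl, fun γ _ v b _ _ => ?_⟩
    simp [softDist_zero]
  | succ t ih =>
    obtain ⟨C, hC0, hC⟩ := ih
    refine ⟨∑ _s : S, ∑ _a : A, |K| * (2 * C + 1), by positivity, fun γ hγ v b hb hv => ?_⟩
    have hterm := fun s a s' => differentiableAt_weighted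
        (fun γ' => M.softDist_mem_stdSimplex z hμ₀ γ' t.castSucc)
        (M.differentiableAt_softDist z hμ₀ γ t.castSucc)
        (hasFDerivAt_softmax γ t (z s) a).differentiableAt s (f := fun μ => M.trans t μ s a s')
        (fun _ => ⟨1, Eventually.of_forall fun γ' _ => M.abs_trans_le_one z hμ₀ γ' t s a s'⟩)
        (fun h => hγ.trans t s h a s')
    refine (pi_norm_le_iff_of_nonneg (by positivity)).2 fun s' => ?_
    have happ : fderiv ℝ (fun γ' => M.softDist μ₀ z γ' t.succ) γ v s' =
        fderiv ℝ (fun γ' => M.softDist μ₀ z γ' t.succ s') γ v := by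
      rw [fderiv_apply (M.differentiableAt_softDist z hμ₀ γ t.succ)]
      rfl
    rw [happ]
    simp only [softDist_succ]
    rw [fderiv_fun_sum fun s _ => DifferentiableAt.fun_sum fun a _ => (hterm s a s').1, sum_apply,
      Finset.sum_mul]
    refine (norm_sum_le _ _).trans (Finset.sum_le_sum fun s _ => ?_)
    rw [fderiv_fun_sum fun a _ => (hterm s a s').1, sum_apply, Finset.sum_mul]
    refine (norm_sum_le _ _).trans (Finset.sum_le_sum fun a _ => ?_)
    have hw : |softmax γ t (z s) a| ≤ 1 := by
      rw [abs_of_pos (softmax_pos γ t (z s) a)]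
      exact softmax_le_one γ t (z s) a
    refine ((hterm s a s').2 hw v (C * b) b (hC γ hγ v b hb hv) (fun h => hv t s h a) hb
      hγ.nonneg).trans ?_
    rw [abs_of_nonneg hγ.nonneg]
    exact le_of_eq (by ring)

theorem differentiableAt_softValue [Nonempty A] (hμ₀ : μ₀ ∈ stdSimplex ℝ S)
    {γ : Fin T × Z × A → ℝ} (hr : M.RewardsBoundedNear μ₀ z γ) :
    DifferentiableAt ℝ (M.softValue μ₀ z) γ := by
  have hfun : M.softValue μ₀ z = fun γ => _ := funext fun γ => M.softValue_eq z γ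
  rw [hfun]
  refine DifferentiableAt.fun_add (DifferentiableAt.fun_sum fun t _ =>
    DifferentiableAt.fun_sum fun s _ => DifferentiableAt.fun_sum fun a _ => ?_)
    (DifferentiableAt.fun_sum fun s _ => ?_)
  · by_cases hpos : 0 < M.softDist μ₀ z γ t.castSucc s
    · obtain ⟨K, hK⟩ := (M.reward_smooth t s a).exists_regularAt
        ⟨M.softDist_mem_stdSimplex z hμ₀ γ t.castSucc, hpos⟩
      exact (differentiableAt_weighted (fun γ' => M.softDist_mem_stdSimplex z hμ₀ γ' t.castSucc)
        (M.differentiableAt_softDist z hμ₀ γ t.castSucc)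
        (hasFDerivAt_softmax γ t (z s) a).differentiableAt s
        (f := fun μ => M.reward t μ s a) (hr.1 t s a) fun _ => hK).1
    · exact (differentiableAt_weighted (fun γ' => M.softDist_mem_stdSimplex z hμ₀ γ' t.castSucc)
        (M.differentiableAt_softDist z hμ₀ γ t.castSucc)
        (hasFDerivAt_softmax γ t (z s) a).differentiableAt s
        (f := fun μ => M.reward t μ s a) (K := 0) (hr.1 t s a) fun h => absurd h hpos).1
  · by_cases hpos : 0 < M.softDist μ₀ z γ (Fin.last T) s
    · obtain ⟨K, hK⟩ := (M.terminalReward_smooth s).exists_regularAt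
        ⟨M.softDist_mem_stdSimplex z hμ₀ γ (Fin.last T), hpos⟩
      exact (differentiableAt_weighted (fun γ' => M.softDist_mem_stdSimplex z hμ₀ γ' (Fin.last T))
        (M.differentiableAt_softDist z hμ₀ γ (Fin.last T))
        (differentiableAt_const 1) s
        (f := fun μ => M.terminalReward μ s) (hr.2 s) fun _ => hK).1
    · exact (differentiableAt_weighted (fun γ' => M.softDist_mem_stdSimplex z hμ₀ γ' (Fin.last T))
        (M.differentiableAt_softDist z hμ₀ γ (Fin.last T))
        (differentiableAt_const 1) s
        (f := fun μ => M.terminalReward μ s) (K := 0) (hr.2 s) fun h => absurd h hpos).1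

/-- The objective changes at most in proportion to the action probabilities. -/
theorem exists_abs_fderiv_softValue_le [Nonempty A] (hμ₀ : μ₀ ∈ stdSimplex ℝ S) (K : ℝ) :
    ∃ C, 0 ≤ C ∧ ∀ γ, M.BoundedAt μ₀ z K γ → M.RewardsBoundedNear μ₀ z γ →
      ∀ v b, 0 ≤ b → M.PolicyRateLE μ₀ z γ v b →
      |fderiv ℝ (M.softValue μ₀ z) γ v| ≤ C * b := by
  obtain ⟨C, hC0, hC⟩ := M.exists_norm_fderiv_softDist_le z hμ₀ K
  refine ⟨(∑ _t : Fin T, ∑ _s : S, ∑ _a : A, |K| * (2 * C + 1)) +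
    ∑ _s : S, |K| * (2 * C + 1), by positivity, fun γ hγ hr v b hb hv => ?_⟩
  have h1 := fun t s a => differentiableAt_weighted
    (fun γ' => M.softDist_mem_stdSimplex z hμ₀ γ' t.castSucc)
    (M.differentiableAt_softDist z hμ₀ γ t.castSucc)
    (hasFDerivAt_softmax γ t (z s) a).differentiableAt s
    (f := fun μ => M.reward t μ s a) (hr.1 t s a) fun h => hγ.reward t s h a
  have h2 := fun s => differentiableAt_weighted
    (fun γ' => M.softDist_mem_stdSimplex z hμ₀ γ' (Fin.last T))
    (M.differentiableAt_softDist z hμ₀ γ (Fin.last T))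
    (differentiableAt_const (1 : ℝ)) s
    (f := fun μ => M.terminalReward μ s) (hr.2 s) fun h => hγ.terminalReward s h
  have hfun : M.softValue μ₀ z = fun γ => _ := funext fun γ => M.softValue_eq z γ
  rw [hfun, fderiv_fun_add (DifferentiableAt.fun_sum fun t _ =>
    DifferentiableAt.fun_sum fun s _ => DifferentiableAt.fun_sum fun a _ => (h1 t s a).1)
    (DifferentiableAt.fun_sum fun s _ => (h2 s).1), add_apply, add_mul]
  refine (abs_add_le _ _).trans (add_le_add ?_ ?_)
  · rw [fderiv_fun_sum fun t _ =>
      DifferentiableAt.fun_sum fun s _ => DifferentiableAt.fun_sum fun a _ => (h1 t s a).1,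
      sum_apply, Finset.sum_mul]
    refine (Finset.abs_sum_le_sum_abs _ _).trans (Finset.sum_le_sum fun t _ => ?_)
    rw [fderiv_fun_sum fun s _ => DifferentiableAt.fun_sum fun a _ => (h1 t s a).1,
      sum_apply, Finset.sum_mul]
    refine (Finset.abs_sum_le_sum_abs _ _).trans (Finset.sum_le_sum fun s _ => ?_)
    rw [fderiv_fun_sum fun a _ => (h1 t s a).1, sum_apply, Finset.sum_mul]
    refine (Finset.abs_sum_le_sum_abs _ _).trans (Finset.sum_le_sum fun a _ => ?_)
    have hw : |softmax γ t (z s) a| ≤ 1 := by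
      rw [abs_of_pos (softmax_pos γ t (z s) a)]
      exact softmax_le_one γ t (z s) a
    refine ((h1 t s a).2 hw v (C * b) b (hC γ hγ v b hb hv t.castSucc)
      (fun h => hv t s h a) hb hγ.nonneg).trans ?_
    rw [abs_of_nonneg hγ.nonneg]
    exact le_of_eq (by ring)
  · rw [fderiv_fun_sum fun s _ => (h2 s).1, sum_apply, Finset.sum_mul]
    refine (Finset.abs_sum_le_sum_abs _ _).trans (Finset.sum_le_sum fun s _ => ?_)
    refine ((h2 s).2 (by simp) v (C * b) b (hC γ hγ v b hb hv (Fin.last T))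
      (fun _ => by simpa using hb) hb hγ.nonneg).trans ?_
    rw [abs_of_nonneg hγ.nonneg]
    exact le_of_eq (by ring)

end Dist

end NonlinearMDP

/-! ### Marginals of the trajectory distribution -/

section Chain

variable {S A : Type*} [Fintype S] [Fintype A]

/-- The time marginals of the chain with initial weights `μ` and kernels `w`. -/
def chainDist {T : ℕ} (μ : S → ℝ) (w : Fin T → S → A → S → ℝ) : Fin (T + 1) → S → ℝ :=
  Fin.induction (motive := fun _ => S → ℝ) μ (fun t ν s' => ∑ s, ∑ a, ν s * w t s a s')

theorem chainDist_succ {T : ℕ} (μ : S → ℝ) (w : Fin T → S → A → S → ℝ) (t : Fin T) (s' : S) :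
    chainDist μ w t.succ s' = ∑ s, ∑ a, chainDist μ w t.castSucc s * w t s a s' := rfl

theorem chainDist_tail {T : ℕ} (μ : S → ℝ) (w : Fin (T + 1) → S → A → S → ℝ)
    (t : Fin (T + 1)) :
    chainDist (fun s' => ∑ s, ∑ a, μ s * w 0 s a s') (fun t => w t.succ) t =
      chainDist μ w t.succ := by
  induction t using Fin.induction with
  | zero => rfl
  | succ t ih =>
    funext s'
    rw [chainDist_succ, chainDist_succ, ih]
    rfl

/-- Summing out the first state and the first action of a trajectory. -/
theorem sum_trajectories_succ {T : ℕ}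
    (F : (Fin (T + 2) → S) × (Fin (T + 1) → A) → ℝ) :
    ∑ ω, F ω = ∑ ω : (Fin (T + 1) → S) × (Fin T → A), ∑ s, ∑ a,
      F (Fin.cons s ω.1, Fin.cons a ω.2) := by
  rw [Fintype.sum_prod_type, Fintype.sum_prod_type,
    ← (Fin.consEquiv fun _ : Fin (T + 2) => S).sum_comp, Fintype.sum_prod_type, Finset.sum_comm]
  refine Finset.sum_congr rfl fun x _ => ?_
  rw [Finset.sum_comm (s := (Finset.univ : Finset (Fin T → A)))]
  refine Finset.sum_congr rfl fun s _ => ?_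
  rw [← (Fin.consEquiv fun _ : Fin (T + 1) => A).sum_comp, Fintype.sum_prod_type, Finset.sum_comm]
  rfl

theorem sum_chain {T : ℕ} (μ : S → ℝ) (w : Fin T → S → A → S → ℝ)
    (hw : ∀ t s, ∑ a, ∑ s', w t s a s' = 1) :
    ∑ ω : (Fin (T + 1) → S) × (Fin T → A),
      μ (ω.1 0) * ∏ t : Fin T, w t (ω.1 t.castSucc) (ω.2 t) (ω.1 t.succ) = ∑ s, μ s := by
  induction T generalizing μ with
  | zero =>
    rw [Fintype.sum_prod_type]
    simp only [Finset.univ_eq_empty, Finset.prod_empty, mul_one, Finset.sum_const,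
      Finset.card_univ, Fintype.card_unique, one_smul]
    exact (Equiv.funUnique (Fin 1) S).sum_comp μ
  | succ T ih =>
    have h := ih (fun s' => ∑ s, ∑ a, μ s * w 0 s a s') (fun t => w t.succ) fun t => hw t.succ
    rw [sum_trajectories_succ]
    have hmass : ∑ s', ∑ s, ∑ a, μ s * w 0 s a s' = ∑ s, μ s := by
      rw [Finset.sum_comm]
      refine Finset.sum_congr rfl fun s _ => ?_
      rw [Finset.sum_comm]
      simp only [← Finset.mul_sum, hw, mul_one]
    rw [hmass] at h
    rw [← h]
    refine Finset.sum_congr rfl fun ω _ => ?_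
    rw [Finset.sum_mul]
    refine Finset.sum_congr rfl fun s _ => ?_
    rw [Finset.sum_mul]
    refine Finset.sum_congr rfl fun a _ => ?_
    simp [Fin.prod_univ_succ, mul_assoc]

/-- The expectation of a function of the state and the action at time `t`. -/
theorem sum_chain_mul {T : ℕ} (μ : S → ℝ) (w : Fin T → S → A → S → ℝ)
    (hw : ∀ t s, ∑ a, ∑ s', w t s a s' = 1) (t : Fin T) (f : S → A → ℝ) :
    ∑ ω : (Fin (T + 1) → S) × (Fin T → A),
      (μ (ω.1 0) * ∏ t : Fin T, w t (ω.1 t.castSucc) (ω.2 t) (ω.1 t.succ)) *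
        f (ω.1 t.castSucc) (ω.2 t) =
      ∑ s, ∑ a, chainDist μ w t.castSucc s * (∑ s', w t s a s') * f s a := by
  induction T generalizing μ with
  | zero => exact t.elim0
  | succ T ih =>
    rw [sum_trajectories_succ]
    refine Fin.cases ?_ (fun t => ?_) t
    · -- at time zero, the function is absorbed into the initial weights of the remaining chain
      have h := sum_chain (fun s' => ∑ s, ∑ a, μ s * w 0 s a s' * f s a) (fun t => w t.succ)
        fun t => hw t.succ
      have hmass : ∑ s', ∑ s, ∑ a, μ s * w 0 s a s' * f s a =
          ∑ s, ∑ a, chainDist μ w (Fin.castSucc 0) s * (∑ s', w 0 s a s') * f s a := by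
        rw [Finset.sum_comm]
        refine Finset.sum_congr rfl fun s _ => ?_
        rw [Finset.sum_comm]
        refine Finset.sum_congr rfl fun a _ => ?_
        rw [Finset.mul_sum, Finset.sum_mul]
        rfl
      rw [← hmass, ← h]
      refine Finset.sum_congr rfl fun ω _ => ?_
      rw [Finset.sum_mul]
      refine Finset.sum_congr rfl fun s _ => ?_
      rw [Finset.sum_mul]
      refine Finset.sum_congr rfl fun a _ => ?_
      simp [Fin.prod_univ_succ]
      ring
    · have h := ih (fun s' => ∑ s, ∑ a, μ s * w 0 s a s') (fun t => w t.succ)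
        (fun t => hw t.succ) t
      rw [chainDist_tail] at h
      rw [Fin.castSucc_succ, ← h]
      refine Finset.sum_congr rfl fun ω _ => ?_
      rw [Finset.sum_mul, Finset.sum_mul]
      refine Finset.sum_congr rfl fun s _ => ?_
      rw [Finset.sum_mul, Finset.sum_mul]
      refine Finset.sum_congr rfl fun a _ => ?_
      simp [Fin.prod_univ_succ, mul_assoc]

end Chain

namespace NonlinearMDP

section Trajectory

variable {S A Z : Type*} [Fintype S] [Fintype A] {T : ℕ}
  (M : NonlinearMDP S A T) {μ₀ : S → ℝ} (z : S → Z)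

theorem softTrajProb_eq (γ : Fin T × Z × A → ℝ) (ω : (Fin (T + 1) → S) × (Fin T → A)) :
    M.softTrajProb μ₀ z γ ω = μ₀ (ω.1 0) * ∏ t : Fin T,
      (softmax γ t (z (ω.1 t.castSucc)) (ω.2 t) *
        M.trans t (M.softDist μ₀ z γ t.castSucc) (ω.1 t.castSucc) (ω.2 t) (ω.1 t.succ)) := rfl

theorem softTrajProb_nonneg [Nonempty A] (hμ₀ : μ₀ ∈ stdSimplex ℝ S) (γ : Fin T × Z × A → ℝ)
    (ω : (Fin (T + 1) → S) × (Fin T → A)) : 0 ≤ M.softTrajProb μ₀ z γ ω := by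
  rw [softTrajProb_eq]
  exact mul_nonneg (hμ₀.1 _) (Finset.prod_nonneg fun t _ => mul_nonneg (softmax_pos _ _ _ _).le
    ((M.trans_mem t _ (M.softDist_mem_stdSimplex z hμ₀ γ t.castSucc) _ _).1 _))

theorem sum_softTrajProb_mul [Nonempty A] (hμ₀ : μ₀ ∈ stdSimplex ℝ S) (γ : Fin T × Z × A → ℝ)
    (t : Fin T) (f : S → A → ℝ) :
    ∑ ω, M.softTrajProb μ₀ z γ ω * f (ω.1 t.castSucc) (ω.2 t) =
      ∑ s, M.softDist μ₀ z γ t.castSucc s * ∑ a, softmax γ t (z s) a * f s a := by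
  have hp := fun t s a => (M.trans_mem t _
    (M.softDist_mem_stdSimplex z hμ₀ γ (Fin.castSucc t)) s a).2
  let w : Fin T → S → A → S → ℝ := fun t s a s' =>
    softmax γ t (z s) a * M.trans t (M.softDist μ₀ z γ t.castSucc) s a s'
  have hsum : ∀ t s a, ∑ s', w t s a s' = softmax γ t (z s) a := by
    intro t s a
    simp only [w, ← Finset.mul_sum, hp, mul_one]
  have hdist : ∀ t, chainDist μ₀ w t = M.softDist μ₀ z γ t := by
    intro t
    induction t using Fin.induction with
    | zero => rfl
    | succ t ih =>
      funext s'
      rw [chainDist_succ, softDist_succ, ih]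
      simp only [w, mul_assoc]
  have h := sum_chain_mul μ₀ w (fun t s => by simp only [hsum, sum_softmax]) t f
  rw [hdist] at h
  simp only [hsum] at h
  refine h.trans ?_
  simp only [Finset.mul_sum, mul_assoc]

/-- A trajectory of positive probability passes through charged states and transitions. -/
theorem pos_of_softTrajProb_pos [Nonempty A] (hμ₀ : μ₀ ∈ stdSimplex ℝ S)
    {γ : Fin T × Z × A → ℝ} {ω : (Fin (T + 1) → S) × (Fin T → A)}
    (hω : 0 < M.softTrajProb μ₀ z γ ω) :
    0 < μ₀ (ω.1 0) ∧ (∀ t : Fin T, 0 < M.trans t (M.softDist μ₀ z γ t.castSucc)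
      (ω.1 t.castSucc) (ω.2 t) (ω.1 t.succ)) ∧ ∀ t, 0 < M.softDist μ₀ z γ t (ω.1 t) := by
  rw [softTrajProb_eq] at hω
  have h0 : 0 < μ₀ (ω.1 0) := (hμ₀.1 _).lt_of_ne fun h => by simp [← h] at hω
  have htr := fun t => M.trans_mem t _ (M.softDist_mem_stdSimplex z hμ₀ γ (Fin.castSucc t))
  have hp : ∀ t : Fin T, 0 < M.trans t (M.softDist μ₀ z γ t.castSucc)
      (ω.1 t.castSucc) (ω.2 t) (ω.1 t.succ) := by
    intro t
    refine ((htr t _ _).1 _).lt_of_ne fun h => ?_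
    rw [Finset.prod_eq_zero (Finset.mem_univ t) (by rw [← h, mul_zero])] at hω
    simp at hω
  refine ⟨h0, hp, fun t => ?_⟩
  induction t using Fin.induction with
  | zero => exact h0
  | succ t ih =>
    rw [softDist_succ]
    have hnn : ∀ s a, 0 ≤ M.softDist μ₀ z γ t.castSucc s * softmax γ t (z s) a *
        M.trans t (M.softDist μ₀ z γ t.castSucc) s a (ω.1 t.succ) := fun s a =>
      mul_nonneg (mul_nonneg ((M.softDist_mem_stdSimplex z hμ₀ γ t.castSucc).1 s)
        (softmax_pos _ _ _ _).le) ((htr t s a).1 _)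
    refine lt_of_lt_of_le (mul_pos (mul_pos ih (softmax_pos γ t (z (ω.1 t.castSucc)) (ω.2 t))) (hp t)) ?_
    exact (Finset.single_le_sum (fun a _ => hnn (ω.1 t.castSucc) a)
      (Finset.mem_univ (ω.2 t))).trans (Finset.single_le_sum
        (f := fun s => ∑ a, M.softDist μ₀ z γ t.castSucc s * softmax γ t (z s) a *
          M.trans t (M.softDist μ₀ z γ t.castSucc) s a (ω.1 t.succ))
        (fun s _ => Finset.sum_nonneg fun a _ => hnn s a) (Finset.mem_univ _))

/-- The probability of a trajectory is at most the product of the probabilities of its actions at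
any set of times. -/
theorem softTrajProb_le_prod [Nonempty A] (hμ₀ : μ₀ ∈ stdSimplex ℝ S)
    (γ : Fin T × Z × A → ℝ) (ω : (Fin (T + 1) → S) × (Fin T → A)) (I : Finset (Fin T)) :
    M.softTrajProb μ₀ z γ ω ≤ ∏ t ∈ I, softmax γ t (z (ω.1 t.castSucc)) (ω.2 t) := by
  rw [softTrajProb_eq]
  have hp := fun t => M.trans_mem t _ (M.softDist_mem_stdSimplex z hμ₀ γ (Fin.castSucc t))
  have hp1 := M.trans_le_one z hμ₀ γ
  have h0 : μ₀ (ω.1 0) ≤ 1 := by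
    rw [← hμ₀.2]
    exact Finset.single_le_sum (fun i _ => hμ₀.1 i) (Finset.mem_univ _)
  have hnn : ∀ t : Fin T, 0 ≤ softmax γ t (z (ω.1 t.castSucc)) (ω.2 t) *
      M.trans t (M.softDist μ₀ z γ t.castSucc) (ω.1 t.castSucc) (ω.2 t) (ω.1 t.succ) := fun t =>
    mul_nonneg (softmax_pos _ _ _ _).le ((hp t _ _).1 _)
  calc _ ≤ 1 * ∏ t : Fin T, (softmax γ t (z (ω.1 t.castSucc)) (ω.2 t) *
        M.trans t (M.softDist μ₀ z γ t.castSucc) (ω.1 t.castSucc) (ω.2 t) (ω.1 t.succ)) :=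
        mul_le_mul_of_nonneg_right h0 (Finset.prod_nonneg fun t _ => hnn t)
    _ ≤ ∏ t ∈ I, (softmax γ t (z (ω.1 t.castSucc)) (ω.2 t) *
        M.trans t (M.softDist μ₀ z γ t.castSucc) (ω.1 t.castSucc) (ω.2 t) (ω.1 t.succ)) := by
        rw [one_mul]
        rw [← Finset.prod_mul_prod_compl I]
        exact mul_le_of_le_one_right (Finset.prod_nonneg fun t _ => hnn t)
          (Finset.prod_le_one (fun t _ => hnn t) fun t _ => mul_le_one₀ (softmax_le_one _ _ _ _)
            ((hp t _ _).1 _) (hp1 _ _ _ _))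
    _ ≤ _ := Finset.prod_le_prod (fun t _ => hnn t) fun t _ =>
        mul_le_of_le_one_right (softmax_pos _ _ _ _).le (hp1 _ _ _ _)

end Trajectory

end NonlinearMDP

/-! ### Fisher information matrices -/

theorem sum_apply_single_mul {ι : Type*} [Fintype ι] [DecidableEq ι] (L : (ι → ℝ) →L[ℝ] ℝ)
    (v : ι → ℝ) : ∑ i, L (Pi.single i 1) * v i = L v := by
  conv_rhs => rw [pi_eq_sum_univ' v]
  simp only [map_sum, map_smul, smul_eq_mul]
  exact Finset.sum_congr rfl fun i _ => mul_comm _ _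

theorem grad_dotProduct {ι : Type*} [Fintype ι] [DecidableEq ι] (f : (ι → ℝ) → ℝ)
    (x v : ι → ℝ) : grad f x ⬝ᵥ v = fderiv ℝ f x v :=
  sum_apply_single_mul _ v

section ActionScore

variable {A Z : Type*} [Fintype A] {T : ℕ}

/-- The derivative of the log-probability of the action `a` along `v`. -/
noncomputable def actionScore (γ : Fin T × Z × A → ℝ) (t : Fin T) (z : Z) (a : A) (v : Fin T × Z × A → ℝ) : ℝ :=
  v (t, z, a) - ∑ b, softmax γ t z b * v (t, z, b)

theorem softmax_mul_actionScore [Fintype Z] [Nonempty A] (γ : Fin T × Z × A → ℝ) (t : Fin T)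
    (z : Z) (a : A) (v : Fin T × Z × A → ℝ) : softmax γ t z a * actionScore γ t z a v =
      fderiv ℝ (fun γ' : Fin T × Z × A → ℝ => softmax γ' t z a) γ v :=
  (fderiv_softmax_apply γ v t z a).symm

theorem sum_softmax_mul_actionScore [Nonempty A] (γ : Fin T × Z × A → ℝ) (t : Fin T)
    (z : Z) (v : Fin T × Z × A → ℝ) : ∑ a, softmax γ t z a * actionScore γ t z a v = 0 := by
  simp only [actionScore, mul_sub, Finset.sum_sub_distrib, ← Finset.sum_mul, sum_softmax,
    one_mul, sub_self]

theorem actionScore_eq_zero [Nonempty A] {γ v : Fin T × Z × A → ℝ} {t : Fin T} {z : Z}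
    (hv : ∀ a b, v (t, z, a) = v (t, z, b)) (a : A) : actionScore γ t z a v = 0 := by
  rw [actionScore, Finset.sum_congr rfl fun b _ => by rw [hv b a],
    ← Finset.sum_mul, sum_softmax, one_mul, sub_self]

variable [DecidableEq Z] [DecidableEq A]

theorem actionScore_single (γ : Fin T × Z × A → ℝ) (t : Fin T) (z : Z) (a : A)
    (a' : A) : actionScore γ t z a (Pi.single (t, z, a') 1) =
      (if a = a' then 1 else 0) - softmax γ t z a' := by
  simp [actionScore, Pi.single_apply]

theorem actionScore_single_of_ne (γ : Fin T × Z × A → ℝ) {t : Fin T} {z : Z} (a : A)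
    {i : Fin T × Z × A} (h : ¬ (t = i.1 ∧ z = i.2.1)) :
    actionScore γ t z a (Pi.single i 1) = 0 := by
  have h1 : ∀ b, (Pi.single i (1 : ℝ) : Fin T × Z × A → ℝ) (t, z, b) = 0 := by
    intro b
    rw [Pi.single_apply, if_neg]
    rintro rfl
    exact h ⟨rfl, rfl⟩
  simp [actionScore, h1]

variable [Fintype Z]

theorem sum_actionScore_single_mul [Nonempty A] (γ : Fin T × Z × A → ℝ) (t : Fin T) (z : Z)
    (a : A) (v : Fin T × Z × A → ℝ) :
    ∑ i, actionScore γ t z a (Pi.single i 1) * v i = actionScore γ t z a v := by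
  simp only [actionScore, ← fderiv_log_softmax_apply]
  exact sum_apply_single_mul _ v

theorem softmax_mul_abs_actionScore_single_le [Nonempty A] (γ : Fin T × Z × A → ℝ) (t : Fin T)
    (z : Z) (a : A) (i : Fin T × Z × A) :
    softmax γ t z a * |actionScore γ t z a (Pi.single i 1)| ≤ softmax γ i.1 i.2.1 i.2.2 := by
  have h := abs_fderiv_softmax_single_le γ i t z a
  rwa [← softmax_mul_actionScore, abs_mul, abs_of_pos (softmax_pos γ t z a)] at h

theorem policyScore_eq {S : Type*} [Nonempty A] (z : S → Z) (γ : Fin T × Z × A → ℝ) (t : Fin T)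
    (s : S) (a : A) (i : Z × A) : NonlinearMDP.policyScore z γ t s a i =
      actionScore γ t (z s) a (Pi.single (t, i) 1) :=
  fderiv_log_softmax_apply γ _ t (z s) a

end ActionScore

namespace NonlinearMDP

section Score

variable {S A Z : Type*} [Fintype S] [Fintype A] {T : ℕ}
  (M : NonlinearMDP S A T) (μ₀ : S → ℝ) (z : S → Z)

/-- The part of the score of a trajectory that comes from the dependence of the transition
probabilities on the state distributions. -/
noncomputable def transScore [Fintype Z] (γ : Fin T × Z × A → ℝ) (ω : (Fin (T + 1) → S) × (Fin T → A))
    (v : Fin T × Z × A → ℝ) : ℝ :=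
  ∑ t : Fin T, (M.trans t (M.softDist μ₀ z γ t.castSucc)
      (ω.1 t.castSucc) (ω.2 t) (ω.1 t.succ))⁻¹ *
    fderiv ℝ (fun γ' => M.trans t (M.softDist μ₀ z γ' t.castSucc)
      (ω.1 t.castSucc) (ω.2 t) (ω.1 t.succ)) γ v

variable [Fintype Z] {μ₀}

theorem differentiableAt_trans [Nonempty A] (hμ₀ : μ₀ ∈ stdSimplex ℝ S) {γ : Fin T × Z × A → ℝ}
    {t : Fin T} {s : S} (hs : 0 < M.softDist μ₀ z γ t.castSucc s) (a : A) (s' : S) :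
    DifferentiableAt ℝ (fun γ' => M.trans t (M.softDist μ₀ z γ' t.castSucc) s a s') γ := by
  obtain ⟨K, hK⟩ := (M.trans_smooth t s a s').exists_regularAt
    ⟨M.softDist_mem_stdSimplex z hμ₀ γ t.castSucc, hs⟩
  exact (hK.comp (fun γ' => M.softDist_mem_stdSimplex z hμ₀ γ' t.castSucc)
    (M.differentiableAt_softDist z hμ₀ γ t.castSucc) hs).1

theorem fderiv_log_softTrajProb_apply [Nonempty A] (hμ₀ : μ₀ ∈ stdSimplex ℝ S)
    {γ : Fin T × Z × A → ℝ} {ω : (Fin (T + 1) → S) × (Fin T → A)}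
    (hω : 0 < M.softTrajProb μ₀ z γ ω) (v : Fin T × Z × A → ℝ) :
    fderiv ℝ (fun γ' => Real.log (M.softTrajProb μ₀ z γ' ω)) γ v =
      ∑ t, actionScore γ t (z (ω.1 t.castSucc)) (ω.2 t) v + M.transScore μ₀ z γ ω v := by
  obtain ⟨h0, hp, hs⟩ := M.pos_of_softTrajProb_pos z hμ₀ hω
  have hd := fun t : Fin T => M.differentiableAt_trans z hμ₀ (hs t.castSucc) (ω.2 t) (ω.1 t.succ)
  have hπ := fun t : Fin T => hasFDerivAt_softmax γ t (z (ω.1 t.castSucc)) (ω.2 t)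
  have hev : (fun γ' => Real.log (M.softTrajProb μ₀ z γ' ω)) =ᶠ[𝓝 γ] fun γ' =>
      Real.log (μ₀ (ω.1 0)) + ∑ t : Fin T, (Real.log (softmax γ' t (z (ω.1 t.castSucc)) (ω.2 t)) +
        Real.log (M.trans t (M.softDist μ₀ z γ' t.castSucc)
          (ω.1 t.castSucc) (ω.2 t) (ω.1 t.succ))) := by
    have hall : ∀ᶠ γ' in 𝓝 γ, ∀ t : Fin T, 0 < M.trans t (M.softDist μ₀ z γ' t.castSucc)
        (ω.1 t.castSucc) (ω.2 t) (ω.1 t.succ) :=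
      eventually_all.2 fun t => (hd t).continuousAt.eventually (lt_mem_nhds (hp t))
    filter_upwards [hall] with γ' hγ'
    have hne : ∀ t ∈ Finset.univ, softmax γ' t (z (ω.1 t.castSucc)) (ω.2 t) *
        M.trans t (M.softDist μ₀ z γ' t.castSucc) (ω.1 t.castSucc) (ω.2 t) (ω.1 t.succ) ≠ 0 :=
      fun t _ => (mul_pos (softmax_pos _ _ _ _) (hγ' t)).ne'
    rw [softTrajProb_eq, Real.log_mul h0.ne' (Finset.prod_ne_zero_iff.2 hne), Real.log_prod hne]
    congr 1
    exact Finset.sum_congr rfl fun t _ => Real.log_mul (softmax_pos _ _ _ _).ne' (hγ' t).ne'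
  have h1 := fun t : Fin T => ((hπ t).log (softmax_pos _ _ _ _).ne').differentiableAt
  have h2 := fun t : Fin T => (hd t).log (hp t).ne'
  rw [hev.fderiv_eq, fderiv_const_add, fderiv_fun_sum fun t _ => (h1 t).fun_add (h2 t), sum_apply,
    transScore, ← Finset.sum_add_distrib]
  refine Finset.sum_congr rfl fun t _ => ?_
  rw [fderiv_fun_add (h1 t) (h2 t), add_apply, fderiv_log_softmax_apply,
    fderiv.log (hd t) (hp t).ne']
  rfl

theorem exists_abs_transScore_le [Nonempty A] (hμ₀ : μ₀ ∈ stdSimplex ℝ S) (K : ℝ) :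
    ∃ C, 0 ≤ C ∧ ∀ γ, M.BoundedAt μ₀ z K γ → ∀ ω, 0 < M.softTrajProb μ₀ z γ ω →
      ∀ v b, 0 ≤ b → M.PolicyRateLE μ₀ z γ v b → |M.transScore μ₀ z γ ω v| ≤ C * b := by
  obtain ⟨C, hC0, hC⟩ := M.exists_norm_fderiv_softDist_le z hμ₀ K
  refine ⟨∑ _t : Fin T, |K| * (|K| * C), by positivity, fun γ hγ ω hω v b hb hv => ?_⟩
  obtain ⟨-, hp, hs⟩ := M.pos_of_softTrajProb_pos z hμ₀ hω
  rw [transScore, Finset.sum_mul, abs_of_nonneg hγ.nonneg]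
  refine (Finset.abs_sum_le_sum_abs _ _).trans (Finset.sum_le_sum fun t _ => ?_)
  rw [abs_mul, abs_inv, abs_of_pos (hp t)]
  have h1 := ((hγ.trans t _ (hs t.castSucc) (ω.2 t) (ω.1 t.succ)).comp
    (fun γ' => M.softDist_mem_stdSimplex z hμ₀ γ' t.castSucc)
    (M.differentiableAt_softDist z hμ₀ γ t.castSucc) (hs t.castSucc)).2 v
  have h2 := hγ.one_le_trans t _ (hs t.castSucc) (ω.2 t) (ω.1 t.succ) (hp t)
  have h3 : (M.trans t (M.softDist μ₀ z γ t.castSucc)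
      (ω.1 t.castSucc) (ω.2 t) (ω.1 t.succ))⁻¹ ≤ K := (inv_le_iff_one_le_mul₀ (hp t)).2 h2
  have h4 := hC γ hγ v b hb hv t.castSucc
  have hK := hγ.nonneg
  calc _ ≤ K * (K * (C * b)) := by
        refine mul_le_mul h3 (h1.trans ?_) (abs_nonneg _) hK
        gcongr
    _ = K * (K * C) * b := by ring

theorem policyRateLE_zero [Nonempty A] {γ v : Fin T × Z × A → ℝ}
    (hv : ∀ t s, 0 < M.softDist μ₀ z γ (Fin.castSucc t) s →
      ∀ a b, v (t, z s, a) = v (t, z s, b)) : M.PolicyRateLE μ₀ z γ v 0 :=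
  fun t s hs a => by rw [fderiv_softmax_eq_zero (hv t s hs), abs_zero]

variable [DecidableEq Z] [DecidableEq A]

theorem policyRateLE_single [Nonempty A] (γ : Fin T × Z × A → ℝ) (i : Fin T × Z × A) :
    M.PolicyRateLE μ₀ z γ (Pi.single i 1) (softmax γ i.1 i.2.1 i.2.2) :=
  fun t s _ a => abs_fderiv_softmax_single_le γ i t (z s) a

theorem fisher_apply (γ : Fin T × Z × A → ℝ) (i j : Fin T × Z × A) :
    M.fisher μ₀ z γ i j = ∑ ω, M.softTrajProb μ₀ z γ ω *
      (fderiv ℝ (fun γ' => Real.log (M.softTrajProb μ₀ z γ' ω)) γ (Pi.single i 1) *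
       fderiv ℝ (fun γ' => Real.log (M.softTrajProb μ₀ z γ' ω)) γ (Pi.single j 1)) := by
  rw [fisher, Matrix.sum_apply]
  rfl

theorem approxFisher_apply [Nonempty A] (γ : Fin T × Z × A → ℝ) (i j : Fin T × Z × A) :
    M.approxFisher μ₀ z γ i j = ∑ ω, M.softTrajProb μ₀ z γ ω *
      (actionScore γ i.1 (z (ω.1 i.1.castSucc)) (ω.2 i.1) (Pi.single i 1) *
       actionScore γ i.1 (z (ω.1 i.1.castSucc)) (ω.2 i.1) (Pi.single j 1)) := by
  obtain ⟨t, i⟩ := i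
  obtain ⟨t', j⟩ := j
  rw [approxFisher, Matrix.of_apply]
  by_cases h : t = t'
  · subst h
    rw [if_pos rfl, policyFisher, Matrix.sum_apply]
    refine Finset.sum_congr rfl fun ω _ => ?_
    simp only [Matrix.smul_apply, Matrix.vecMulVec_apply, policyScore_eq, smul_eq_mul]
  · rw [if_neg h]
    refine (Finset.sum_eq_zero fun ω _ => ?_).symm
    rw [actionScore_single_of_ne γ (i := (t', j)) _ fun h' => h h'.1, mul_zero, mul_zero]

theorem fisher_transpose (γ : Fin T × Z × A → ℝ) :
    (M.fisher μ₀ z γ).transpose = M.fisher μ₀ z γ := by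
  ext i j
  simp only [Matrix.transpose_apply, fisher_apply]
  exact Finset.sum_congr rfl fun ω _ => by ring

theorem approxFisher_transpose (γ : Fin T × Z × A → ℝ) :
    (M.approxFisher μ₀ z γ).transpose = M.approxFisher μ₀ z γ := by
  ext i j
  simp only [Matrix.transpose_apply, approxFisher, Matrix.of_apply]
  by_cases h : i.1 = j.1
  · rw [if_pos h, if_pos h.symm, h, policyFisher, Matrix.sum_apply, Matrix.sum_apply]
    refine Finset.sum_congr rfl fun ω _ => ?_
    simp only [Matrix.smul_apply, Matrix.vecMulVec_apply, mul_comm]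
  · rw [if_neg h, if_neg fun h' => h h'.symm]

theorem fisher_mulVec_eq_zero [Nonempty A] (hμ₀ : μ₀ ∈ stdSimplex ℝ S) {K : ℝ}
    {γ v : Fin T × Z × A → ℝ} (hγ : M.BoundedAt μ₀ z K γ)
    (hv : ∀ t s, 0 < M.softDist μ₀ z γ (Fin.castSucc t) s →
      ∀ a b, v (t, z s, a) = v (t, z s, b)) : (M.fisher μ₀ z γ).mulVec v = 0 := by
  funext i
  simp only [Matrix.mulVec, dotProduct, fisher_apply, Finset.sum_mul, Pi.zero_apply]
  rw [Finset.sum_comm]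
  refine Finset.sum_eq_zero fun ω _ => ?_
  simp only [mul_assoc]
  rw [← Finset.mul_sum, ← Finset.mul_sum, sum_apply_single_mul]
  rcases (M.softTrajProb_nonneg z hμ₀ γ ω).eq_or_lt with h | h
  · rw [← h, zero_mul]
  · obtain ⟨C, -, hC⟩ := M.exists_abs_transScore_le z hμ₀ K
    have h1 := hC γ hγ ω h v 0 le_rfl (M.policyRateLE_zero z hv)
    rw [mul_zero, abs_nonpos_iff] at h1
    obtain ⟨-, -, hs⟩ := M.pos_of_softTrajProb_pos z hμ₀ h
    rw [M.fderiv_log_softTrajProb_apply z hμ₀ h v, h1, Finset.sum_eq_zero fun t _ =>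
      actionScore_eq_zero (hv t _ (hs t.castSucc)) (ω.2 t), add_zero, mul_zero, mul_zero]

/-- In softmax parameters, the approximate Fisher matrix acts on each pair of a time and an expert
as the covariance matrix of the action, times the probability that the expert acts. -/
theorem approxFisher_mulVec_apply [Nonempty A] (hμ₀ : μ₀ ∈ stdSimplex ℝ S)
    (γ v : Fin T × Z × A → ℝ) (t : Fin T) (x : Z) (a : A) :
    (M.approxFisher μ₀ z γ).mulVec v (t, x, a) =
      (∑ s with z s = x, M.softDist μ₀ z γ t.castSucc s) *
        (softmax γ t x a * (v (t, x, a) - ∑ b, softmax γ t x b * v (t, x, b))) := by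
  have h1 : (M.approxFisher μ₀ z γ).mulVec v (t, x, a) = ∑ ω, M.softTrajProb μ₀ z γ ω *
      (fun s b => actionScore γ t (z s) b (Pi.single (t, x, a) 1) * actionScore γ t (z s) b v)
        (ω.1 t.castSucc) (ω.2 t) := by
    simp only [Matrix.mulVec, dotProduct, approxFisher_apply, Finset.sum_mul]
    rw [Finset.sum_comm]
    refine Finset.sum_congr rfl fun ω _ => ?_
    simp only [mul_assoc]
    rw [← Finset.mul_sum, ← Finset.mul_sum, sum_actionScore_single_mul]
  rw [h1, M.sum_softTrajProb_mul z hμ₀ γ t fun s b =>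
    actionScore γ t (z s) b (Pi.single (t, x, a) 1) * actionScore γ t (z s) b v, Finset.sum_filter, Finset.sum_mul]
  refine Finset.sum_congr rfl fun s _ => ?_
  by_cases hs : z s = x
  · subst hs
    rw [if_pos rfl]
    congr 1
    simp only [actionScore_single, sub_mul, mul_sub, Finset.sum_sub_distrib]
    have h2 : ∑ b, softmax γ t (z s) b * (softmax γ t (z s) a * actionScore γ t (z s) b v) = 0 := by
      rw [← mul_zero (softmax γ t (z s) a), ← sum_softmax_mul_actionScore γ t (z s) v,
        Finset.mul_sum]
      exact Finset.sum_congr rfl fun b _ => by ring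
    rw [h2]
    simp [actionScore, mul_sub]
  · rw [if_neg hs, zero_mul]
    have h2 : ∀ b, actionScore γ t (z s) b (Pi.single (t, x, a) 1) = 0 := fun b =>
      actionScore_single_of_ne γ b fun h => hs h.2
    simp [h2]

/-- The entries of the difference of the Fisher matrices are of the order of the product of the
two action probabilities, whereas the diagonal entries of either matrix are of the order of a
single one. -/
theorem exists_abs_fisher_sub_approxFisher_le [Nonempty A] (hμ₀ : μ₀ ∈ stdSimplex ℝ S) (K : ℝ) :
    ∃ C, 0 ≤ C ∧ ∀ γ, M.BoundedAt μ₀ z K γ → ∀ i j,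
      |(M.fisher μ₀ z γ - M.approxFisher μ₀ z γ) i j| ≤
        C * (softmax γ i.1 i.2.1 i.2.2 * softmax γ j.1 j.2.1 j.2.2) := by
  obtain ⟨C, hC0, hC⟩ := M.exists_abs_transScore_le z hμ₀ K
  refine ⟨∑ _ω : (Fin (T + 1) → S) × (Fin T → A), (1 + 2 * C + C * C), by positivity,
    fun γ hγ i j => ?_⟩
  rw [Matrix.sub_apply, fisher_apply, approxFisher_apply, ← Finset.sum_sub_distrib, Finset.sum_mul]
  refine (Finset.abs_sum_le_sum_abs _ _).trans (Finset.sum_le_sum fun ω _ => ?_)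
  have hi0 := softmax_pos γ i.1 i.2.1 i.2.2
  have hj0 := softmax_pos γ j.1 j.2.1 j.2.2
  set θi := softmax γ i.1 i.2.1 i.2.2
  set θj := softmax γ j.1 j.2.1 j.2.2
  rcases (M.softTrajProb_nonneg z hμ₀ γ ω).eq_or_lt with h | h
  · rw [← h]
    simp only [zero_mul, sub_zero, abs_zero]
    positivity
  have hgi := hC γ hγ ω h _ _ hi0.le (M.policyRateLE_single z γ i)
  have hgj := hC γ hγ ω h _ _ hj0.le (M.policyRateLE_single z γ j)
  have hscore : ∀ k : Fin T × Z × A,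
      fderiv ℝ (fun γ' => Real.log (M.softTrajProb μ₀ z γ' ω)) γ (Pi.single k 1) =
      actionScore γ k.1 (z (ω.1 k.1.castSucc)) (ω.2 k.1) (Pi.single k 1) +
        M.transScore μ₀ z γ ω (Pi.single k 1) := by
    intro k
    rw [M.fderiv_log_softTrajProb_apply z hμ₀ h, Finset.sum_eq_single k.1 _ (by simp)]
    exact fun t _ ht => actionScore_single_of_ne γ _ fun h => ht h.1
  have hle := M.softTrajProb_le_prod z hμ₀ γ ω
  have hf := fun k : Fin T × Z × A =>
    softmax_mul_abs_actionScore_single_le γ k.1 (z (ω.1 k.1.castSucc)) (ω.2 k.1) k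
  have hq1 : M.softTrajProb μ₀ z γ ω ≤ 1 := by simpa using hle ∅
  have hqf : ∀ k : Fin T × Z × A, M.softTrajProb μ₀ z γ ω *
      |actionScore γ k.1 (z (ω.1 k.1.castSucc)) (ω.2 k.1) (Pi.single k 1)| ≤
        softmax γ k.1 k.2.1 k.2.2 := by
    intro k
    refine le_trans ?_ (hf k)
    gcongr
    simpa using hle {k.1}
  -- products of action scores at distinct times are also of second order
  have hmain : |M.softTrajProb μ₀ z γ ω *
      (actionScore γ i.1 (z (ω.1 i.1.castSucc)) (ω.2 i.1) (Pi.single i 1) *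
        actionScore γ j.1 (z (ω.1 j.1.castSucc)) (ω.2 j.1) (Pi.single j 1) -
      actionScore γ i.1 (z (ω.1 i.1.castSucc)) (ω.2 i.1) (Pi.single i 1) *
        actionScore γ i.1 (z (ω.1 i.1.castSucc)) (ω.2 i.1) (Pi.single j 1))| ≤ θi * θj := by
    by_cases hij : i.1 = j.1
    · rw [hij, sub_self, mul_zero, abs_zero]
      positivity
    · rw [actionScore_single_of_ne γ (t := i.1) (i := j) _ fun h' => hij h'.1, mul_zero, sub_zero,
        abs_mul, abs_mul, abs_of_pos h]
      have h2 := hle {i.1, j.1}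
      rw [Finset.prod_pair hij] at h2
      calc _ ≤ (softmax γ i.1 (z (ω.1 i.1.castSucc)) (ω.2 i.1) *
            softmax γ j.1 (z (ω.1 j.1.castSucc)) (ω.2 j.1)) * _ :=
            mul_le_mul_of_nonneg_right h2 (by positivity)
        _ = (softmax γ i.1 (z (ω.1 i.1.castSucc)) (ω.2 i.1) * _) *
            (softmax γ j.1 (z (ω.1 j.1.castSucc)) (ω.2 j.1) * _) := mul_mul_mul_comm _ _ _ _
        _ ≤ θi * θj := mul_le_mul (hf i) (hf j)
            (mul_nonneg (softmax_pos _ _ _ _).le (abs_nonneg _)) hi0.le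
  rw [hscore i, hscore j]
  have hfi := hqf i
  have hfj := hqf j
  set q := M.softTrajProb μ₀ z γ ω
  set fi := actionScore γ i.1 (z (ω.1 i.1.castSucc)) (ω.2 i.1) (Pi.single i 1)
  set fj := actionScore γ j.1 (z (ω.1 j.1.castSucc)) (ω.2 j.1) (Pi.single j 1)
  set gi := M.transScore μ₀ z γ ω (Pi.single i 1)
  set gj := M.transScore μ₀ z γ ω (Pi.single j 1)
  set e := actionScore γ i.1 (z (ω.1 i.1.castSucc)) (ω.2 i.1) (Pi.single j 1)
  calc |q * ((fi + gi) * (fj + gj)) - q * (fi * e)|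
      = |q * (fi * fj - fi * e) + (q * fi) * gj + (q * fj) * gi + q * (gi * gj)| := by ring_nf
    _ ≤ |q * (fi * fj - fi * e)| + |(q * fi) * gj| + |(q * fj) * gi| + |q * (gi * gj)| :=
        (abs_add_le _ _).trans (by gcongr; exact abs_add_three _ _ _)
    _ ≤ θi * θj + θi * (C * θj) + θj * (C * θi) + 1 * ((C * θi) * (C * θj)) := by
        simp only [abs_mul, abs_of_pos h] at hmain ⊢
        gcongr
    _ = (1 + 2 * C + C * C) * (θi * θj) := by ring

end Score

end NonlinearMDP

/-! ### Pseudoinverses under perturbations -/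

section Pinv

variable {n : Type*} [Fintype n]

/-- Solutions given by the pseudoinverse are orthogonal to the null space. -/
theorem pinv_mulVec_dotProduct_eq_zero (F : Matrix n n ℝ) (d : n → ℝ) {v : n → ℝ}
    (hv : F.mulVec v = 0) : (pinv F).mulVec d ⬝ᵥ v = 0 := by
  have h := pinv_spec F
  have h1 : (pinv F).mulVec d = (pinv F * F).transpose.mulVec ((pinv F).mulVec d) := by
    rw [h.right_symm, Matrix.mulVec_mulVec, h.mul_self_mul]
  rw [h1, Matrix.mulVec_transpose, ← Matrix.dotProduct_mulVec, ← Matrix.mulVec_mulVec, hv,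
    Matrix.mulVec_zero, dotProduct_zero]

/-- The pseudoinverse of a symmetric matrix solves the linear system if the right-hand side is
orthogonal to the null space. -/
theorem mulVec_pinv_mulVec {F : Matrix n n ℝ} (hF : F.transpose = F) {d : n → ℝ}
    (hd : ∀ v, F.mulVec v = 0 → d ⬝ᵥ v = 0) : F.mulVec ((pinv F).mulVec d) = d := by
  have h := pinv_spec F
  have h1 : F * (F * pinv F) = F := by
    have h2 : F * pinv F = (pinv F).transpose * F := by
      conv_lhs => rw [← h.left_symm, Matrix.transpose_mul, hF]
    have h3 := congrArg Matrix.transpose h.mul_mul_self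
    rw [Matrix.transpose_mul, Matrix.transpose_mul, hF] at h3
    rw [h2, h3]
  set r := d - F.mulVec ((pinv F).mulVec d) with hr
  have hFr : F.mulVec r = 0 := by
    rw [hr, Matrix.mulVec_sub, Matrix.mulVec_mulVec, Matrix.mulVec_mulVec, Matrix.mul_assoc, h1,
      sub_self]
  have hrr : r ⬝ᵥ r = 0 := by
    conv_lhs => lhs; rw [hr]
    rw [sub_dotProduct, hd r hFr, ← hF, Matrix.mulVec_transpose, ← Matrix.dotProduct_mulVec, hFr,
      dotProduct_zero, sub_zero]
  exact (sub_eq_zero.1 (dotProduct_self_eq_zero.1 hrr)).symm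

end Pinv

section Block

variable {τ Z A : Type*}

/-- The coefficients do not depend on the action at the pairs of positive mass `m`. -/
def IsBlockConst (m : τ → Z → ℝ) (v : τ × Z × A → ℝ) : Prop :=
  ∀ t x, 0 < m t x → ∀ a b, v (t, x, a) = v (t, x, b)

/-- The vector vanishes at the distinguished actions and at the pairs without mass. -/
def IsAnchored (m : τ → Z → ℝ) (c : τ → Z → A) (y : τ × Z × A → ℝ) : Prop :=
  ∀ t x, y (t, x, c t x) = 0 ∧ (¬ 0 < m t x → ∀ a, y (t, x, a) = 0)

open Classical in
/-- The anchored representative of a vector modulo the block constant vectors. -/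
noncomputable def anchor (m : τ → Z → ℝ) (c : τ → Z → A) (y : τ × Z × A → ℝ) : τ × Z × A → ℝ :=
  fun i => if 0 < m i.1 i.2.1 then y i - y (i.1, i.2.1, c i.1 i.2.1) else 0

theorem isAnchored_anchor (m : τ → Z → ℝ) (c : τ → Z → A) (y : τ × Z × A → ℝ) :
    IsAnchored m c (anchor m c y) := by
  intro t x
  constructor
  · simp [anchor]
  · intro h a
    simp [anchor, h]

theorem isBlockConst_sub_anchor (m : τ → Z → ℝ) (c : τ → Z → A) (y : τ × Z × A → ℝ) :
    IsBlockConst m (y - anchor m c y) := by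
  intro t x h a b
  simp [anchor, h]

variable [Fintype τ] [Fintype Z] [Fintype A]

theorem mulVec_anchor {F : Matrix (τ × Z × A) (τ × Z × A) ℝ} {m : τ → Z → ℝ}
    (hF : ∀ v, IsBlockConst m v → F.mulVec v = 0) (c : τ → Z → A) (y : τ × Z × A → ℝ) :
    F.mulVec (anchor m c y) = F.mulVec y := by
  have h := hF _ (isBlockConst_sub_anchor m c y)
  rw [Matrix.mulVec_sub, sub_eq_zero] at h
  exact h.symm

/-- On the orthogonal complement of the block constant vectors, the anchored representative
controls the vector. -/
theorem norm_le_of_orthogonal_isBlockConst {m : τ → Z → ℝ} (c : τ → Z → A)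
    {y : τ × Z × A → ℝ} (hy : ∀ v, IsBlockConst m v → y ⬝ᵥ v = 0) :
    ‖y‖ ≤ 2 * ‖anchor m c y‖ := by
  classical
  refine (pi_norm_le_iff_of_nonneg (by positivity)).2 ?_
  rintro ⟨t, x, a⟩
  have hN := norm_nonneg (anchor m c y)
  by_cases hm : 0 < m t x
  · have hsum : ∑ b, y (t, x, b) = 0 := by
      have h := hy (fun i => if i.1 = t ∧ i.2.1 = x then 1 else 0) fun t' x' _ a b => rfl
      have h2 : ∀ i : τ × Z × A, y i * (if i.1 = t ∧ i.2.1 = x then 1 else 0) =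
          if i.1 = t then (if i.2.1 = x then y i else 0) else 0 := by
        intro i
        by_cases h1 : i.1 = t <;> by_cases h2 : i.2.1 = x <;> simp [h1, h2]
      simp only [dotProduct, h2] at h
      rw [Fintype.sum_prod_type, Finset.sum_eq_single t (fun t' _ h => by simp [h]) (by simp),
        Fintype.sum_prod_type, Finset.sum_eq_single x (fun x' _ h => by simp [h]) (by simp)] at h
      simpa using h
    have hanch : ∀ b, y (t, x, b) = anchor m c y (t, x, b) + y (t, x, c t x) := by
      intro b
      simp [anchor, hm]
    have hb : ∀ b, |anchor m c y (t, x, b)| ≤ ‖anchor m c y‖ := fun b =>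
      norm_le_pi_norm (anchor m c y) (t, x, b)
    have hcard : (0 : ℝ) < Fintype.card A := by
      exact_mod_cast Fintype.card_pos_iff.2 ⟨a⟩
    have hc : |y (t, x, c t x)| ≤ ‖anchor m c y‖ := by
      rw [Finset.sum_congr rfl fun b _ => hanch b, Finset.sum_add_distrib, Finset.sum_const,
        Finset.card_univ, nsmul_eq_mul] at hsum
      have h1 : Fintype.card A * |y (t, x, c t x)| = |∑ b, anchor m c y (t, x, b)| := by
        rw [eq_neg_of_add_eq_zero_left hsum, abs_neg, abs_mul, Nat.abs_cast]
      have h2 : |∑ b, anchor m c y (t, x, b)| ≤ Fintype.card A * ‖anchor m c y‖ := by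
        refine (Finset.abs_sum_le_sum_abs _ _).trans ((Finset.sum_le_sum fun b _ => hb b).trans ?_)
        simp
      rw [← h1] at h2
      exact le_of_mul_le_mul_left h2 hcard
    rw [hanch a, Real.norm_eq_abs]
    exact (abs_add_le _ _).trans (by linarith [hb a])
  · have h := hy (Pi.single (t, x, a) 1) fun t' x' h' a' b' => by
      have hne : ∀ b, (t', x', b) ≠ (t, x, a) := by
        rintro b ⟨⟩
        exact hm h'
      rw [Pi.single_eq_of_ne (hne a'), Pi.single_eq_of_ne (hne b')]
    rw [dotProduct_single, mul_one] at h
    rw [h, norm_zero]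
    positivity

section Estimates

variable {m : τ → Z → ℝ} {θ : τ → Z → A → ℝ} {c : τ → Z → A}

theorem one_sub_le_sum (hθ : ∀ t x a, 0 < θ t x a) (hθ1 : ∀ t x, ∑ a, θ t x a = 1) (t : τ) (x : Z) :
    1 - θ t x (c t x) ≤ ∑ t, ∑ x, (1 - θ t x (c t x)) := by
  have h : ∀ t x, 0 ≤ 1 - θ t x (c t x) := fun t x => by
    rw [sub_nonneg, ← hθ1 t x]
    exact Finset.single_le_sum (fun a _ => (hθ t x a).le) (Finset.mem_univ _)
  exact (Finset.single_le_sum (f := fun x => 1 - θ t x (c t x)) (fun x _ => h t x)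
    (Finset.mem_univ x)).trans (Finset.single_le_sum
      (f := fun t => ∑ x, (1 - θ t x (c t x))) (fun t _ => Finset.sum_nonneg fun x _ => h t x)
      (Finset.mem_univ t))

theorem sum_mul_abs_block_le (hθ : ∀ t x a, 0 < θ t x a) (hθ1 : ∀ t x, ∑ a, θ t x a = 1)
    {y : τ × Z × A → ℝ} (hy : IsAnchored m c y) (t : τ) (x : Z) :
    ∑ a, θ t x a * |y (t, x, a)| ≤ (1 - θ t x (c t x)) * ‖y‖ := by
  classical
  have h1 : ∑ a, θ t x a * |y (t, x, a)| =
      ∑ a ∈ Finset.univ.erase (c t x), θ t x a * |y (t, x, a)| := by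
    rw [← Finset.add_sum_erase _ _ (Finset.mem_univ (c t x)), (hy t x).1, abs_zero, mul_zero,
      zero_add]
  have h2 : 1 - θ t x (c t x) = ∑ a ∈ Finset.univ.erase (c t x), θ t x a := by
    rw [← hθ1 t x, ← Finset.add_sum_erase _ _ (Finset.mem_univ (c t x))]
    ring
  rw [h1, h2, Finset.sum_mul]
  exact Finset.sum_le_sum fun a _ =>
    mul_le_mul_of_nonneg_left (norm_le_pi_norm y (t, x, a)) (hθ t x a).le

/-- A perturbation with entries of the order of `θ i * θ j` is small on anchored vectors, relative
to `θ i`, if all `θ t x` are almost concentrated at the distinguished actions. -/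
theorem abs_mulVec_le (hθ : ∀ t x a, 0 < θ t x a) (hθ1 : ∀ t x, ∑ a, θ t x a = 1)
    {E : Matrix (τ × Z × A) (τ × Z × A) ℝ} {C : ℝ} (hC : 0 ≤ C)
    (hE : ∀ i j, |E i j| ≤ C * (θ i.1 i.2.1 i.2.2 * θ j.1 j.2.1 j.2.2))
    {y : τ × Z × A → ℝ} (hy : IsAnchored m c y) (i : τ × Z × A) :
    |E.mulVec y i| ≤ θ i.1 i.2.1 i.2.2 * (C * (∑ t, ∑ x, (1 - θ t x (c t x))) * ‖y‖) := by
  have hi := hθ i.1 i.2.1 i.2.2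
  have hsum : ∑ j : τ × Z × A, θ j.1 j.2.1 j.2.2 * |y j| ≤
      (∑ t, ∑ x, (1 - θ t x (c t x))) * ‖y‖ := by
    rw [Fintype.sum_prod_type, Finset.sum_mul]
    refine Finset.sum_le_sum fun t _ => ?_
    rw [Fintype.sum_prod_type, Finset.sum_mul]
    exact Finset.sum_le_sum fun x _ => sum_mul_abs_block_le hθ hθ1 hy t x
  calc |E.mulVec y i| ≤ ∑ j, |E i j * y j| := Finset.abs_sum_le_sum_abs _ _
    _ ≤ ∑ j : τ × Z × A, C * θ i.1 i.2.1 i.2.2 * (θ j.1 j.2.1 j.2.2 * |y j|) := by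
        refine Finset.sum_le_sum fun j _ => ?_
        rw [abs_mul]
        refine (mul_le_mul_of_nonneg_right (hE i j) (abs_nonneg _)).trans (le_of_eq (by ring))
    _ = C * θ i.1 i.2.1 i.2.2 * ∑ j : τ × Z × A, θ j.1 j.2.1 j.2.2 * |y j| := by
        rw [Finset.mul_sum]
    _ ≤ C * θ i.1 i.2.1 i.2.2 * ((∑ t, ∑ x, (1 - θ t x (c t x))) * ‖y‖) := by gcongr
    _ = _ := by ring

/-- Rows of the block covariance matrix `G` carry the factor `θ i`. Dividing by it bounds anchored
solutions of a linear system whose right-hand side carries the same factor, although `G` tends to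
zero at different rates in different rows. -/
theorem norm_le_of_abs_mulVec_le (hθ : ∀ t x a, 0 < θ t x a) (hθ1 : ∀ t x, ∑ a, θ t x a = 1)
    {G : Matrix (τ × Z × A) (τ × Z × A) ℝ}
    (hG : ∀ v t x a, G.mulVec v (t, x, a) =
      m t x * (θ t x a * (v (t, x, a) - ∑ b, θ t x b * v (t, x, b))))
    {K : ℝ} (hK : 0 ≤ K) (hm : ∀ t x, 0 < m t x → 1 ≤ K * m t x)
    (hδ : ∑ t, ∑ x, (1 - θ t x (c t x)) ≤ 1 / 2) {y : τ × Z × A → ℝ} (hy : IsAnchored m c y)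
    {ρ : ℝ} (hρ : 0 ≤ ρ) (hr : ∀ i, |G.mulVec y i| ≤ θ i.1 i.2.1 i.2.2 * ρ) :
    ‖y‖ ≤ 2 * (K * ρ) := by
  have h : ‖y‖ ≤ K * ρ + 1 / 2 * ‖y‖ := by
    refine (pi_norm_le_iff_of_nonneg (by positivity)).2 ?_
    rintro ⟨t, x, a⟩
    rw [Real.norm_eq_abs]
    by_cases hmx : 0 < m t x
    · have h1 := hr (t, x, a)
      rw [hG, abs_mul, abs_mul, abs_of_pos hmx, abs_of_pos (hθ t x a), mul_left_comm] at h1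
      have h2 := le_of_mul_le_mul_left h1 (hθ t x a)
      have h3 : |y (t, x, a) - ∑ b, θ t x b * y (t, x, b)| ≤ K * ρ := by
        calc _ ≤ K * m t x * |y (t, x, a) - ∑ b, θ t x b * y (t, x, b)| :=
              le_mul_of_one_le_left (abs_nonneg _) (hm t x hmx)
          _ = K * (m t x * |y (t, x, a) - ∑ b, θ t x b * y (t, x, b)|) := mul_assoc _ _ _
          _ ≤ K * ρ := by gcongr
      have h4 : |∑ b, θ t x b * y (t, x, b)| ≤ 1 / 2 * ‖y‖ := by
        refine (Finset.abs_sum_le_sum_abs _ _).trans ?_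
        simp only [abs_mul, abs_of_pos (hθ t x _)]
        refine (sum_mul_abs_block_le hθ hθ1 hy t x).trans ?_
        gcongr
        exact (one_sub_le_sum hθ hθ1 t x).trans hδ
      calc |y (t, x, a)| = |(y (t, x, a) - ∑ b, θ t x b * y (t, x, b)) +
            ∑ b, θ t x b * y (t, x, b)| := by rw [sub_add_cancel]
        _ ≤ _ := (abs_add_le _ _).trans (add_le_add h3 h4)
    · rw [(hy t x).2 hmx a, abs_zero]
      positivity
  linarith

/-- Comparison of the pseudoinverse solutions for the block covariance matrix `G` and for a
perturbation `F` of second order. The bound is proportional to the distance of `θ` from the pure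
policy `c`. -/
theorem norm_pinv_mulVec_sub_le (hθ : ∀ t x a, 0 < θ t x a) (hθ1 : ∀ t x, ∑ a, θ t x a = 1)
    {F G : Matrix (τ × Z × A) (τ × Z × A) ℝ} (hFs : F.transpose = F) (hGs : G.transpose = G)
    (hG : ∀ v t x a, G.mulVec v (t, x, a) =
      m t x * (θ t x a * (v (t, x, a) - ∑ b, θ t x b * v (t, x, b))))
    (hm0 : ∀ t x, 0 ≤ m t x) {K C : ℝ} (hK : 0 ≤ K) (hm : ∀ t x, 0 < m t x → 1 ≤ K * m t x)
    (hC : 0 ≤ C)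
    (hE : ∀ i j, |(F - G) i j| ≤ C * (θ i.1 i.2.1 i.2.2 * θ j.1 j.2.1 j.2.2))
    (hF0 : ∀ v, IsBlockConst m v → F.mulVec v = 0) {d : τ × Z × A → ℝ}
    (hd0 : ∀ v, IsBlockConst m v → d ⬝ᵥ v = 0) (hd : ∀ i, |d i| ≤ θ i.1 i.2.1 i.2.2 * C)
    (hδ : ∑ t, ∑ x, (1 - θ t x (c t x)) ≤ 1 / 2)
    (hδC : 2 * (K * (C * ∑ t, ∑ x, (1 - θ t x (c t x)))) ≤ 1 / 2) :
    ‖(pinv F).mulVec d - (pinv G).mulVec d‖ ≤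
      16 * (K * C) ^ 2 * ∑ t, ∑ x, (1 - θ t x (c t x)) := by
  set δ := ∑ t, ∑ x, (1 - θ t x (c t x)) with hδdef
  have hδ0 : 0 ≤ δ := Finset.sum_nonneg fun t _ => Finset.sum_nonneg fun x _ => by
    rw [sub_nonneg, ← hθ1 t x]
    exact Finset.single_le_sum (fun a _ => (hθ t x a).le) (Finset.mem_univ _)
  have hG0 : ∀ v, IsBlockConst m v → G.mulVec v = 0 := by
    intro v hv
    funext ⟨t, x, a⟩
    rw [hG, Pi.zero_apply]
    rcases (hm0 t x).eq_or_lt with h | h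
    · rw [← h, zero_mul]
    · rw [Finset.sum_congr rfl fun b _ => by rw [hv t x h b a], ← Finset.sum_mul, hθ1, one_mul,
        sub_self, mul_zero, mul_zero]
  have hE0 : ∀ v, IsBlockConst m v → (F - G).mulVec v = 0 := by
    intro v hv
    rw [Matrix.sub_mulVec, hF0 v hv, hG0 v hv, sub_zero]
  -- the null spaces of both matrices consist of the block constant vectors
  have hker : ∀ v, F.mulVec v = 0 → IsBlockConst m v := by
    intro v hv
    have ha := isAnchored_anchor m c v
    have h1 : G.mulVec (anchor m c v) = -(F - G).mulVec (anchor m c v) := by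
      rw [Matrix.sub_mulVec, mulVec_anchor hF0, hv, zero_sub, neg_neg]
    have h2 := norm_le_of_abs_mulVec_le hθ hθ1 hG hK hm hδ ha
      (ρ := C * δ * ‖anchor m c v‖) (by positivity) fun i => by
        rw [h1, Pi.neg_apply, abs_neg]
        exact abs_mulVec_le hθ hθ1 hC hE ha i
    have h3 : anchor m c v = 0 := by
      rw [← norm_le_zero_iff]
      nlinarith [norm_nonneg (anchor m c v)]
    have h4 := isBlockConst_sub_anchor m c v
    rwa [h3, sub_zero] at h4
  have hkerG : ∀ v, G.mulVec v = 0 → IsBlockConst m v := by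
    intro v hv
    have ha := isAnchored_anchor m c v
    have h2 := norm_le_of_abs_mulVec_le hθ hθ1 hG hK hm hδ ha (ρ := 0) le_rfl fun i => by
      rw [mulVec_anchor hG0, hv]
      simp
    have h3 : anchor m c v = 0 := by
      rw [← norm_le_zero_iff]
      simpa using h2
    have h4 := isBlockConst_sub_anchor m c v
    rwa [h3, sub_zero] at h4
  set x := (pinv F).mulVec d with hx
  set x' := (pinv G).mulVec d with hx'
  have hFx : F.mulVec x = d := mulVec_pinv_mulVec hFs fun v hv => hd0 v (hker v hv)
  have hGx : G.mulVec x' = d := mulVec_pinv_mulVec hGs fun v hv => hd0 v (hkerG v hv)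
  have hx'norm : ‖anchor m c x'‖ ≤ 2 * (K * C) :=
    norm_le_of_abs_mulVec_le hθ hθ1 hG hK hm hδ (isAnchored_anchor m c x') hC fun i => by
      rw [mulVec_anchor hG0, hGx]
      exact hd i
  have horth : ∀ v, IsBlockConst m v → (x - x') ⬝ᵥ v = 0 := fun v hv => by
    rw [sub_dotProduct, hx, hx', pinv_mulVec_dotProduct_eq_zero F d (hF0 v hv),
      pinv_mulVec_dotProduct_eq_zero G d (hG0 v hv), sub_zero]
  have ha := isAnchored_anchor m c (x - x')
  have heq : G.mulVec (anchor m c (x - x')) =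
      -((F - G).mulVec (anchor m c (x - x')) + (F - G).mulVec (anchor m c x')) := by
    rw [mulVec_anchor hG0, mulVec_anchor hE0, mulVec_anchor hE0, ← Matrix.mulVec_add,
      sub_add_cancel, Matrix.mulVec_sub, Matrix.sub_mulVec, hFx, hGx]
    abel
  have hmain := norm_le_of_abs_mulVec_le hθ hθ1 hG hK hm hδ ha
    (ρ := C * δ * (‖anchor m c (x - x')‖ + ‖anchor m c x'‖)) (by positivity) fun i => by
      rw [heq, Pi.neg_apply, abs_neg, Pi.add_apply]
      refine (abs_add_le _ _).trans ((add_le_add (abs_mulVec_le hθ hθ1 hC hE ha i)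
        (abs_mulVec_le hθ hθ1 hC hE (isAnchored_anchor m c x') i)).trans (le_of_eq ?_))
      ring
  have hy : ‖anchor m c (x - x')‖ ≤ 8 * (K * C) ^ 2 * δ := by
    have h1 : 2 * (K * (C * δ)) * ‖anchor m c (x - x')‖ ≤ 1 / 2 * ‖anchor m c (x - x')‖ := by
      gcongr
    have h2 : 2 * (K * (C * δ)) * ‖anchor m c x'‖ ≤ 2 * (K * (C * δ)) * (2 * (K * C)) := by
      gcongr
    nlinarith
  calc ‖x - x'‖ ≤ 2 * ‖anchor m c (x - x')‖ := norm_le_of_orthogonal_isBlockConst c horth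
    _ ≤ 2 * (8 * (K * C) ^ 2 * δ) := by gcongr
    _ = 16 * (K * C) ^ 2 * δ := by ring

end Estimates

end Block

/-! ### Uniform bounds along the sequence -/

theorem exists_eventually_forall_of_monotone {ι N : Type*} [Finite ι] {l : Filter N}
    {P : ι → ℝ → N → Prop} (hP : ∀ i n, Monotone fun K => P i K n)
    (h : ∀ i, ∃ K, ∀ᶠ n in l, P i K n) : ∃ K, 0 ≤ K ∧ ∀ᶠ n in l, ∀ i, P i K n := by
  cases nonempty_fintype ι
  choose K hK using h
  refine ⟨∑ i, |K i|, by positivity, eventually_all.2 fun i => ?_⟩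
  filter_upwards [hK i] with n hn
  exact hP i n ((le_abs_self _).trans
    (Finset.single_le_sum (f := fun i => |K i|) (fun i _ => abs_nonneg _) (Finset.mem_univ i))) hn

theorem exists_eventually_one_le_mul {N : Type*} {l : Filter N} {u : N → ℝ} {a : ℝ}
    (hu : Tendsto u l (𝓝 a)) (ha : 0 < a) : ∃ K, ∀ᶠ n in l, 1 ≤ K * u n := by
  refine ⟨(a / 2)⁻¹, ?_⟩
  filter_upwards [hu.eventually (lt_mem_nhds (half_lt_self ha))] with n hn
  rw [inv_mul_eq_div, one_le_div (half_pos ha)]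
  exact hn.le

namespace NonlinearMDP

variable {S A Z : Type*} [Fintype S] [Fintype A] {T : ℕ}

/-- If the supports of the state distributions and of the transitions stabilize to those of the
limit, then the data along the sequence are bounded in the sense of `BoundedAt`. -/
theorem exists_eventually_boundedAt [Nonempty A] (M : NonlinearMDP S A T) {μ₀ : S → ℝ}
    (hμ₀ : μ₀ ∈ stdSimplex ℝ S) (z : S → Z) {γ : ℕ → Fin T × Z × A → ℝ}
    {μstar : Fin (T + 1) → S → ℝ}
    (hμstar : Tendsto (fun n => M.softDist μ₀ z (γ n)) atTop (𝓝 μstar))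
    (hstate : ∀ t : Fin (T + 1), ∀ᶠ n in atTop,
      {s | 0 < M.softDist μ₀ z (γ n) t s} = {s | 0 < μstar t s})
    (htrans : ∀ t : Fin T, ∀ᶠ n in atTop,
      M.transSupport t (M.softDist μ₀ z (γ n) t.castSucc) =
        M.transSupport t (μstar t.castSucc)) :
    ∃ K, ∀ᶠ n in atTop, M.BoundedAt μ₀ z K (γ n) := by
  have hlim : ∀ t, Tendsto (fun n => M.softDist μ₀ z (γ n) t) atTop (𝓝 (μstar t)) := fun t =>
    (tendsto_pi_nhds.1 hμstar) t
  have hmem : ∀ t, μstar t ∈ stdSimplex ℝ S := fun t =>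
    (isClosed_stdSimplex ℝ S).mem_of_tendsto (hlim t)
      (Eventually.of_forall fun n => M.softDist_mem_stdSimplex z hμ₀ (γ n) t)
  have hpos : ∀ t s, ∀ᶠ n in atTop, (0 < M.softDist μ₀ z (γ n) t s ↔ 0 < μstar t s) := by
    intro t s
    filter_upwards [hstate t] with n hn
    exact Set.ext_iff.1 hn s
  have hcharge : ∀ t s, 0 < μstar t s →
      ∀ᶠ n in atTop, M.softDist μ₀ z (γ n) t ∈ pmfsCharging s := by
    intro t s hs
    filter_upwards [hpos t s] with n hn
    exact ⟨M.softDist_mem_stdSimplex z hμ₀ (γ n) t, hn.2 hs⟩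
  -- at states that the limit does not charge, there is nothing to bound
  have hred : ∀ t s (P : ℝ → ℕ → Prop), (0 < μstar t s → ∃ K, ∀ᶠ n in atTop, P K n) →
      ∃ K, ∀ᶠ n in atTop, 0 < M.softDist μ₀ z (γ n) t s → P K n := by
    intro t s P hP
    by_cases h : 0 < μstar t s
    · obtain ⟨K, hK⟩ := hP h
      exact ⟨K, hK.mono fun n hn _ => hn⟩
    · exact ⟨0, (hpos t s).mono fun n hn h' => absurd (hn.1 h') h⟩
  have hreg : ∀ t s (f : (S → ℝ) → ℝ), HasSmoothExtension (pmfsCharging s) f →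
      ∃ K, ∀ᶠ n in atTop, 0 < M.softDist μ₀ z (γ n) t s →
        RegularAt K s f (M.softDist μ₀ z (γ n) t) := fun t s f hf =>
    hred t s (fun K n => RegularAt K s f (M.softDist μ₀ z (γ n) t)) fun h =>
      hf.eventually_regularAt ⟨hmem t, h⟩ (hlim t) (hcharge t s h)
  obtain ⟨K₁, hK₁, h₁⟩ := exists_eventually_forall_of_monotone
    (P := fun (i : Fin T × S × A × S) K n => 0 < M.softDist μ₀ z (γ n) i.1.castSucc i.2.1 →
      RegularAt K i.2.1 (fun μ => M.trans i.1 μ i.2.1 i.2.2.1 i.2.2.2)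
        (M.softDist μ₀ z (γ n) i.1.castSucc)) (l := atTop)
    (fun i n K L hKL h h' => (h h').mono hKL)
    fun i => hreg _ _ _ (M.trans_smooth i.1 i.2.1 i.2.2.1 i.2.2.2)
  obtain ⟨K₂, hK₂, h₂⟩ := exists_eventually_forall_of_monotone
    (P := fun (i : Fin T × S × A) K n => 0 < M.softDist μ₀ z (γ n) i.1.castSucc i.2.1 →
      RegularAt K i.2.1 (fun μ => M.reward i.1 μ i.2.1 i.2.2)
        (M.softDist μ₀ z (γ n) i.1.castSucc)) (l := atTop)
    (fun i n K L hKL h h' => (h h').mono hKL)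
    fun i => hreg _ _ _ (M.reward_smooth i.1 i.2.1 i.2.2)
  obtain ⟨K₃, hK₃, h₃⟩ := exists_eventually_forall_of_monotone
    (P := fun (s : S) K n => 0 < M.softDist μ₀ z (γ n) (Fin.last T) s →
      RegularAt K s (fun μ => M.terminalReward μ s) (M.softDist μ₀ z (γ n) (Fin.last T)))
    (l := atTop) (fun i n K L hKL h h' => (h h').mono hKL)
    fun s => hreg _ _ _ (M.terminalReward_smooth s)
  obtain ⟨K₄, hK₄, h₄⟩ := exists_eventually_forall_of_monotone
    (P := fun (i : Fin T × S) K n => 0 < M.softDist μ₀ z (γ n) i.1.castSucc i.2 →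
      1 ≤ K * M.softDist μ₀ z (γ n) i.1.castSucc i.2) (l := atTop)
    (fun i n K L hKL h h' => (h h').trans (mul_le_mul_of_nonneg_right hKL h'.le))
    fun i => hred _ _ (fun K n => 1 ≤ K * M.softDist μ₀ z (γ n) i.1.castSucc i.2) fun h =>
      exists_eventually_one_le_mul ((tendsto_pi_nhds.1 (hlim i.1.castSucc)) i.2) h
  obtain ⟨K₅, hK₅, h₅⟩ := exists_eventually_forall_of_monotone
    (P := fun (i : Fin T × S × A × S) K n => 0 < M.softDist μ₀ z (γ n) i.1.castSucc i.2.1 →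
      0 < M.trans i.1 (M.softDist μ₀ z (γ n) i.1.castSucc) i.2.1 i.2.2.1 i.2.2.2 →
      1 ≤ K * M.trans i.1 (M.softDist μ₀ z (γ n) i.1.castSucc) i.2.1 i.2.2.1 i.2.2.2)
    (l := atTop)
    (fun i n K L hKL h h' h'' => (h h' h'').trans (mul_le_mul_of_nonneg_right hKL h''.le))
    (by
      rintro ⟨t, s, a, s'⟩
      by_cases h : 0 < μstar t.castSucc s ∧ 0 < M.trans t (μstar t.castSucc) s a s'
      · obtain ⟨f', -, hf'⟩ := (M.trans_smooth t s a s').exists_hasFDerivWithinAt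
        have hc := (hf' _ ⟨hmem t.castSucc, h.1⟩).continuousWithinAt.tendsto.comp
          (tendsto_nhdsWithin_iff.2 ⟨hlim t.castSucc, hcharge t.castSucc s h.1⟩)
        obtain ⟨K, hK⟩ := exists_eventually_one_le_mul hc h.2
        exact ⟨K, hK.mono fun n hn _ _ => hn⟩
      · refine ⟨0, (htrans t).mono fun n hn h1 h2 => absurd ?_ h⟩
        exact (Set.ext_iff.1 hn (s, a, s')).1 ⟨h1, h2⟩)
  refine ⟨K₁ + K₂ + K₃ + K₄ + K₅, ?_⟩
  filter_upwards [h₁, h₂, h₃, h₄, h₅] with n h₁ h₂ h₃ h₄ h₅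
  exact
    { nonneg := by positivity
      trans := fun t s h a s' => (h₁ (t, s, a, s') h).mono (by linarith)
      reward := fun t s h a => (h₂ (t, s, a) h).mono (by linarith)
      terminalReward := fun s h => (h₃ s h).mono (by linarith)
      one_le_dist := fun t s h => (h₄ (t, s) h).trans
        (mul_le_mul_of_nonneg_right (by linarith) h.le)
      one_le_trans := fun t s h a s' h' => (h₅ (t, s, a, s') h h').trans
        (mul_le_mul_of_nonneg_right (by linarith) h'.le) }

/-! ### Comparison of the natural gradients -/

variable [Fintype Z] [DecidableEq Z] [DecidableEq A]

/-- At softmax parameters near a pure policy `c`, the natural gradients differ by at most a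
multiple of the distance to the pure policy. -/
theorem exists_norm_naturalGradient_sub_le [Nonempty A] (M : NonlinearMDP S A T) {μ₀ : S → ℝ}
    (hμ₀ : μ₀ ∈ stdSimplex ℝ S) (z : S → Z) (c : Fin T → Z → A) (K : ℝ) :
    ∃ C δ₀, 0 < δ₀ ∧ ∀ γ, M.BoundedAt μ₀ z K γ → M.RewardsBoundedNear μ₀ z γ →
      ∑ t, ∑ x, (1 - softmax γ t x (c t x)) ≤ δ₀ →
      ‖M.naturalGradient μ₀ z γ - M.approxNaturalGradient μ₀ z γ‖ ≤
        C * ∑ t, ∑ x, (1 - softmax γ t x (c t x)) := by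
  obtain ⟨C₁, hC₁, hE⟩ := M.exists_abs_fisher_sub_approxFisher_le z hμ₀ K
  obtain ⟨C₂, hC₂, hJ⟩ := M.exists_abs_fderiv_softValue_le z hμ₀ K
  let C := C₁ + C₂
  refine ⟨16 * (K * C) ^ 2, 1 / (2 + 4 * (|K| * C)), by positivity, fun γ hγ hr hδ => ?_⟩
  have hKC : 0 ≤ K * C := mul_nonneg hγ.nonneg (add_nonneg hC₁ hC₂)
  rw [abs_of_nonneg hγ.nonneg, le_div_iff₀ (by positivity)] at hδ
  have hδ0 : 0 ≤ ∑ t, ∑ x, (1 - softmax γ t x (c t x)) :=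
    Finset.sum_nonneg fun t _ => Finset.sum_nonneg fun x _ =>
      sub_nonneg.2 (softmax_le_one γ t x _)
  let m : Fin T → Z → ℝ := fun t x => ∑ s with z s = x, M.softDist μ₀ z γ t.castSucc s
  have hdist : ∀ t s, 0 ≤ M.softDist μ₀ z γ t s := fun t =>
    (M.softDist_mem_stdSimplex z hμ₀ γ t).1
  have hle : ∀ (t : Fin T) s, M.softDist μ₀ z γ t.castSucc s ≤ m t (z s) := fun t s =>
    Finset.single_le_sum (fun s _ => hdist t.castSucc s) (by simp)
  have hconst : ∀ v : Fin T × Z × A → ℝ, IsBlockConst m v → ∀ t s,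
      0 < M.softDist μ₀ z γ (Fin.castSucc t) s → ∀ a b, v (t, z s, a) = v (t, z s, b) :=
    fun v hv t s hs => hv t (z s) (hs.trans_le (hle t s))
  refine norm_pinv_mulVec_sub_le (m := m) (θ := softmax γ) (c := c) (softmax_pos γ)
    (sum_softmax γ) (M.fisher_transpose z γ) (M.approxFisher_transpose z γ)
    (M.approxFisher_mulVec_apply z hμ₀ γ)
    (fun t x => Finset.sum_nonneg fun s _ => hdist t.castSucc s) hγ.nonneg ?_
    (add_nonneg hC₁ hC₂) (fun i j => (hE γ hγ i j).trans ?_)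
    (fun v hv => M.fisher_mulVec_eq_zero z hμ₀ hγ (hconst v hv)) (fun v hv => ?_)
    (fun i => ?_) (by nlinarith) (by nlinarith)
  · intro t x hx
    obtain ⟨s, hs, hpos⟩ := Finset.exists_lt_of_sum_lt
      (f := fun _ => (0 : ℝ)) (by simpa only [Finset.sum_const_zero] using hx)
    obtain rfl := (Finset.mem_filter.1 hs).2
    exact (hγ.one_le_dist t s hpos).trans (mul_le_mul_of_nonneg_left (hle t s) hγ.nonneg)
  · have h1 := softmax_pos γ i.1 i.2.1 i.2.2
    have h2 := softmax_pos γ j.1 j.2.1 j.2.2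
    gcongr
    exact le_add_of_nonneg_right hC₂
  · rw [grad_dotProduct]
    have h := hJ γ hγ hr v 0 le_rfl (M.policyRateLE_zero z (hconst v hv))
    rwa [mul_zero, abs_nonpos_iff] at h
  · have h1 := softmax_pos γ i.1 i.2.1 i.2.2
    refine (hJ γ hγ hr _ _ h1.le (M.policyRateLE_single z γ i)).trans ?_
    rw [mul_comm]
    gcongr
    exact le_add_of_nonneg_left hC₁

end NonlinearMDP

theorem IsPurePolicy.exists_eq_one {A Z : Type*} [Fintype A] {T : ℕ} {θ : Fin T → Z → A → ℝ}
    (h : IsPurePolicy θ) : ∃ c : Fin T → Z → A, ∀ t x, θ t x (c t x) = 1 := by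
  choose hθ c hc using h
  refine ⟨c, fun t x => ?_⟩
  rw [← (hθ t x).2]
  refine (Finset.sum_eq_single (c t x) (fun a _ ha => ?_) (by simp)).symm
  by_contra h0
  exact ha (by simpa [hc t x] using Function.mem_support.2 h0)

theorem theorem5 {S A Z : Type*} [Fintype S] [Fintype A] [Fintype Z]
    [DecidableEq Z] [DecidableEq A] {T : ℕ}
    (M : NonlinearMDP S A T) (μ₀ : S → ℝ) (hμ₀ : μ₀ ∈ stdSimplex ℝ S) (z : S → Z)
    (θstar : Fin T → Z → A → ℝ) (hpure : IsPurePolicy θstar)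
    (γ : ℕ → Fin T × Z × A → ℝ) (hγ : ∀ n, γ n ∈ centeredParams T Z A)
    (hlim : Tendsto (fun n => softmax (γ n)) atTop (𝓝 θstar))
    (μstar : Fin (T + 1) → S → ℝ)
    (hμstar : Tendsto (fun n => M.softDist μ₀ z (γ n)) atTop (𝓝 μstar))
    -- the unreachable pairs and the null space are eventually fixed, of the expected dimension
    (hnull : ∃ (U : Set (Fin T × Z)) (N : Submodule ℝ (Fin T × Z × A → ℝ)),
      Module.finrank ℝ N = T * Fintype.card Z + (Fintype.card A - 1) * U.ncard ∧
      ∀ᶠ n in atTop, M.unreachable μ₀ z (γ n) = U ∧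
        LinearMap.ker (M.fisher μ₀ z (γ n)).mulVecLin = N)
    -- the state supports stabilize
    (hstate : ∀ t : Fin (T + 1), ∀ᶠ n in atTop,
      {s | 0 < M.softDist μ₀ z (γ n) t s} = {s | 0 < μstar t s})
    -- the transition supports stabilize
    (htrans : ∀ t : Fin T, ∀ᶠ n in atTop,
      M.transSupport t (M.softDist μ₀ z (γ n) t.castSucc) =
        M.transSupport t (μstar t.castSucc))
    -- the rewards at unreached states do not blow up near the parameters of the sequence
    (hreward : ∀ᶠ n in atTop, M.RewardsBoundedNear μ₀ z (γ n)) :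
    (∀ᶠ n in atTop, DifferentiableAt ℝ (M.softValue μ₀ z) (γ n)) ∧
    Tendsto (fun n => ‖WithLp.toLp 2
      (M.naturalGradient μ₀ z (γ n) - M.approxNaturalGradient μ₀ z (γ n))‖) atTop (𝓝 0) := by
  cases isEmpty_or_nonempty A with
  | inl hA =>
    -- without actions, the parameter space is a point
    refine ⟨Eventually.of_forall fun n => (hasFDerivAt_of_subsingleton _ _).differentiableAt, ?_⟩
    have h : ∀ n, M.naturalGradient μ₀ z (γ n) - M.approxNaturalGradient μ₀ z (γ n) = 0 :=
      fun n => Subsingleton.elim _ _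
    simp [h]
  | inr hA =>
    refine ⟨hreward.mono fun n hn => M.differentiableAt_softValue z hμ₀ hn, ?_⟩
    obtain ⟨c, hc⟩ := hpure.exists_eq_one
    obtain ⟨K, hK⟩ := M.exists_eventually_boundedAt hμ₀ z hμstar hstate htrans
    obtain ⟨C, δ₀, hδ₀, hC⟩ := M.exists_norm_naturalGradient_sub_le hμ₀ z c K
    have hδ : Tendsto (fun n => ∑ t, ∑ x, (1 - softmax (γ n) t x (c t x))) atTop (𝓝 0) := by
      have h : Tendsto (fun n => ∑ t, ∑ x, (1 - softmax (γ n) t x (c t x))) atTop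
          (𝓝 (∑ t, ∑ x, (1 - θstar t x (c t x)))) :=
        tendsto_finsetSum _ fun t _ => tendsto_finsetSum _ fun x _ =>
          (tendsto_pi_nhds.1 (tendsto_pi_nhds.1 (tendsto_pi_nhds.1 hlim t) x) (c t x)).const_sub 1
      simpa [hc] using h
    have hsub : Tendsto (fun n => M.naturalGradient μ₀ z (γ n) -
        M.approxNaturalGradient μ₀ z (γ n)) atTop (𝓝 0) := by
      refine squeeze_zero_norm' (a := fun n => C * ∑ t, ∑ x, (1 - softmax (γ n) t x (c t x)))
        ?_ (by simpa using hδ.const_mul C)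
      filter_upwards [hK, hreward, hδ.eventually (ge_mem_nhds hδ₀)] with n h1 h2 h3
      exact hC (γ n) h1 h2 h3
    have h := ((PiLp.continuous_toLp 2 fun _ : Fin T × Z × A => ℝ).tendsto 0).comp hsub
    simpa using h.norm
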